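/- All graphs are finite. A graph is \emph{distance hereditary} if every connected induced subgraph $H$ of it satisfies $d_H(u,v)=d_G(u,v)$ for all vertices $u,v$ of $H$; a \emph{BDH graph} is a bipartite distance hereditary graph. Multigraphs may have parallel edges; a multigraph with at least two vertices is \emph{2-connected} if it is loopless, connected and has no cut vertex (so two vertices joined by parallel edges form a 2-connected multigraph). A multigraph is \emph{series-parallel} if it can be constructed from a digon (two distinct vertices joined by two edges) by repeatedly either adding a new edge with the same ends as an existing edge, or subdividing an existing edge by a new vertex. For a spanning tree $T$ of a connected multigraph $S$, the \emph{fundamental graph} $G_S(T)$ is the bipartite graph with color classes $E(T)$ and $E(S)\setminus E(T)$ in which $e\in E(T)$ and $f\in E(S)\setminus E(T)$ are adjacent if and only if $e$ belongs to the unique cycle of the graph spanned by $E(T)\cup\{f\}$. \textbf{Theorem.} Let $G$ be a connected bipartite simple graph with color classes $X$ and $Y$ and with at least two vertices. Then $G$ is a BDH graph if and only if there are a 2-connected series-parallel multigraph $S$ and a spanning tree $T$ of $S$ such that $G$ is isomorphic to $G_S(T)$. The same equivalence holds if the isomorphism is moreover required to map $X$ onto $E(T)$ and $Y$ onto $E(S)\setminus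 E(T)$. -/

import Mathlib

open scoped Graph

universe u v w

/-- A simple graph is distance hereditary if every connected induced subgraph inherits its
distance function. -/
def IsDistanceHereditary {V : Type*} (G : SimpleGraph V) : Prop :=
  ∀ s : Set V, (G.induce s).Connected → ∀ u v : s, (G.induce s).dist u v = G.dist u v

/-- BDH graphs: the bipartite distance hereditary graphs. -/
def IsBDH {V : Type*} (G : SimpleGraph V) : Prop :=
  G.IsBipartite ∧ IsDistanceHereditary G

/-- 2-connectedness of a multigraph: at least two vertices, no loops, connected, no cut vertex.
Two vertices joined by one or more edges are allowed. -/
structure IsTwoConnected {α β : Type*} (S : Graph α β) : Prop where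
  nontrivial : V(S).Nontrivial
  loopless : S.Loopless
  connected : S.toSimpleGraph.Connected
  no_cut_vertex : ∀ v ∈ V(S), (S.deleteVerts {v}).toSimpleGraph.Connected

/-- `S'` arises from `S` by adding a new edge `f` with the same ends as the edge `e`. -/
structure IsParallelExtension {α β : Type*} (S S' : Graph α β) (e f : β) : Prop where
  mem : e ∈ E(S)
  notMem : f ∉ E(S)
  vertexSet_eq : V(S') = V(S)
  isLink_iff : ∀ g a b, S'.IsLink g a b ↔ S.IsLink g a b ∨ (g = f ∧ S.IsLink e a b)

/-- `S'` arises from `S` by subdividing the edge `e`, with ends `x` and `y`, by a new vertex `w`: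
the edge `e` now joins `x` to `w`, and a new edge `f` joins `w` to `y`. -/
structure IsSeriesExtension {α β : Type*} (S S' : Graph α β) (e f : β) (x y w : α) : Prop where
  isLink : S.IsLink e x y
  edge_notMem : f ∉ E(S)
  vertex_notMem : w ∉ V(S)
  vertexSet_eq : V(S') = insert w V(S)
  isLink_iff : ∀ g a b, S'.IsLink g a b ↔
    (g ≠ e ∧ S.IsLink g a b) ∨ (g = e ∧ s(a, b) = s(x, w)) ∨ (g = f ∧ s(a, b) = s(w, y))

/-- Series-parallel multigraphs: those constructed from a digon (two edges with the same two
distinct ends) by parallel extensions and series extensions. -/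
inductive IsSeriesParallel {α β : Type*} : Graph α β → Prop
  | digon {x y : α} {e f : β} (hxy : x ≠ y) (hef : e ≠ f) :
      IsSeriesParallel (Graph.banana x y {e, f})
  | parallel {S S' : Graph α β} {e f : β} (hS : IsSeriesParallel S)
      (h : IsParallelExtension S S' e f) : IsSeriesParallel S'
  | series {S S' : Graph α β} {e f : β} {x y w : α} (hS : IsSeriesParallel S)
      (h : IsSeriesExtension S S' e f x y w) : IsSeriesParallel S'

/-- `C` is the edge-set of a cycle of the multigraph `S`: there are `n + 1` distinct vertices and
`n + 1` distinct edges, each edge joining a vertex to the cyclically next one (addition in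
`Fin (n + 1)` wraps around). Loops are the cycles of length one, digons those of length two. -/
def IsCycleEdgeSet {α β : Type*} (S : Graph α β) (C : Set β) : Prop :=
  ∃ (n : ℕ) (v : Fin (n + 1) → α) (e : Fin (n + 1) → β),
    Function.Injective v ∧ Function.Injective e ∧
      (∀ i, S.IsLink (e i) (v i) (v (i + 1))) ∧ Set.range e = C

/-- `T` is the edge-set of a spanning tree of `S`. -/
structure IsSpanningTree {α β : Type*} (S : Graph α β) (T : Set β) : Prop where
  subset : T ⊆ E(S)
  connected : (S.restrict T).toSimpleGraph.Connected
  acyclic : ∀ C ⊆ T, ¬ IsCycleEdgeSet S C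

/-- `e` lies on a cycle whose edges belong to `T ∪ {f}`. If `T` is a spanning tree of `S` and `f`
is an edge outside `T`, there is exactly one such cycle, the fundamental cycle through `f`. -/
def MemFundamentalCycle {α β : Type*} (S : Graph α β) (T : Set β) (f e : β) : Prop :=
  ∃ C, IsCycleEdgeSet S C ∧ C ⊆ insert f T ∧ e ∈ C

/-- The fundamental graph of `S` with respect to the spanning tree `T`: its vertices are the edges
of `S`, and a tree edge is adjacent to a co-tree edge exactly when it lies on the fundamental cycle
through that co-tree edge. -/
def fundamentalGraph {α β : Type*} (S : Graph α β) (T : Set β) : SimpleGraph E(S) where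
  Adj a b :=
    ((a : β) ∈ T ∧ (b : β) ∉ T ∧ MemFundamentalCycle S T b a) ∨
    ((b : β) ∈ T ∧ (a : β) ∉ T ∧ MemFundamentalCycle S T a b)
  symm := ⟨fun _ _ h => h.symm⟩
  loopless := ⟨fun _ h => h.elim (fun h => h.2.1 h.1) (fun h => h.2.1 h.1)⟩

/-! Distance heredity reduces to a local condition, `HasInducedCommonNeighbors`: two nonadjacent
vertices of a connected set `s` with a common neighbor in `G` have one in `s`. This is the
distance-two case of the definition, and it suffices because a walk of `G` can be pushed into `s`
one step at a time (`exists_walkWithin_le`).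

The condition survives the addition of a pendant vertex or a false twin (`insert_pendant`,
`insert_twin`). Conversely, a finite connected bipartite graph with at least two vertices that
satisfies it has a pendant vertex or a pair of false twins (`exists_pendant_or_twin`). So BDH graphs
are built from one edge by these two operations.

Series-parallel extensions do the same to fundamental graphs. An edge added in parallel to `e` is a
new cotree edge, pendant at `e` if `e` is in the tree and a twin of `e` otherwise. Subdividing `e`
and putting the new edge into the tree gives a twin of `e` if `e` is in the tree and a pendant
vertex at `e` otherwise. The four cases match operation and color of the new vertex, and the digon
gives the single edge, so both directions are inductions. A given spanning tree may use `e` and `f`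
the other way round; exchanging the two labels repairs this.

Cycles are handled through reachability: `e` lies on the fundamental cycle of `f` exactly when `T \
{e}` does not join the ends of `f` (`memFundamentalCycle_iff`). Two-connectedness of series-parallel
multigraphs follows from the stronger invariant `IsSturdy`. -/

section

/-! ### Walks and connectivity inside a vertex set -/

namespace SimpleGraph

variable {V V' : Type*} {G : SimpleGraph V} {G' : SimpleGraph V'} {s t : Set V} {a b c : V}
  {m n : ℕ}

/-- There is a walk of length `n` from `a` to `b` in `G` all of whose vertices lie in `s`. -/
inductive WalkWithin (G : SimpleGraph V) (s : Set V) : ℕ → V → V → Prop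
  | nil {a : V} (ha : a ∈ s) : WalkWithin G s 0 a a
  | cons {n : ℕ} {a b c : V} (ha : a ∈ s) (hab : G.Adj a b) (h : WalkWithin G s n b c) :
      WalkWithin G s (n + 1) a c

namespace WalkWithin

theorem left_mem (h : G.WalkWithin s n a b) : a ∈ s := by cases h <;> assumption

theorem right_mem (h : G.WalkWithin s n a b) : b ∈ s := by induction h <;> assumption

theorem trans (h : G.WalkWithin s m a b) (h' : G.WalkWithin s n b c) :
    G.WalkWithin s (m + n) a c := by
  induction h with
  | nil ha => simpa using h'
  | cons ha hab _ ih => rw [Nat.add_right_comm]; exact .cons ha hab (ih h')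

theorem of_adj (ha : a ∈ s) (hb : b ∈ s) (h : G.Adj a b) : G.WalkWithin s 1 a b :=
  .cons ha h (.nil hb)

theorem symm (h : G.WalkWithin s n a b) : G.WalkWithin s n b a := by
  induction h with
  | nil ha => exact .nil ha
  | cons ha hab h ih => exact ih.trans (.of_adj h.left_mem ha hab.symm)

theorem mono (hst : s ⊆ t) (h : G.WalkWithin s n a b) : G.WalkWithin t n a b := by
  induction h with
  | nil ha => exact .nil (hst ha)
  | cons ha hab h ih => exact .cons (hst ha) hab ih

theorem exists_walk_induce (h : G.WalkWithin s n a b) :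
    ∃ p : (G.induce s).Walk ⟨a, h.left_mem⟩ ⟨b, h.right_mem⟩, p.length = n := by
  induction h with
  | nil ha => exact ⟨.nil, rfl⟩
  | cons ha hab h ih =>
    obtain ⟨p, hp⟩ := ih
    exact ⟨.cons (by simpa using hab) p, by simp [hp]⟩

theorem of_walk_induce {x y : s} (p : (G.induce s).Walk x y) : G.WalkWithin s p.length x y := by
  induction p with
  | nil => exact .nil (Subtype.coe_prop _)
  | cons h p ih => exact .cons (Subtype.coe_prop _) (by simpa using h) ih

theorem of_walk (p : G.Walk a b) : G.WalkWithin Set.univ p.length a b := by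
  induction p with
  | nil => exact .nil trivial
  | cons h p ih => exact .cons trivial h ih

theorem exists_walk (h : G.WalkWithin s n a b) : ∃ p : G.Walk a b, p.length = n := by
  induction h with
  | nil ha => exact ⟨.nil, rfl⟩
  | cons ha hab h ih =>
    obtain ⟨p, rfl⟩ := ih
    exact ⟨.cons hab p, rfl⟩

/-- A walk in `insert c s` ending in `s` either avoids `c`, or has a tail in `s` that starts at a
neighbor of `c`. -/
theorem avoid_or_exists_tail (h : G.WalkWithin (insert c s) n a b) (hb : b ∈ s) :
    G.WalkWithin s n a b ∨ ∃ d ∈ s, G.Adj c d ∧ ∃ m < n, G.WalkWithin s m d b := by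
  generalize ht : insert c s = t at h
  induction h with
  | nil ha => exact .inl (.nil hb)
  | cons ha hab h ih =>
    subst ht
    rcases ih hb with hw | ⟨d, hd, hcd, m, hm, hw⟩
    · rcases ha with rfl | ha
      · exact .inr ⟨_, hw.left_mem, hab, _, Nat.lt_succ_self _, hw⟩
      · exact .inl (.cons ha hab hw)
    · exact .inr ⟨d, hd, hcd, m, by omega, hw⟩

/-- A map sending adjacent vertices to equal or adjacent ones sends walks to walks. -/
theorem image {f : V → V'} (h : G.WalkWithin s n a b)
    (hf : ∀ a ∈ s, ∀ b ∈ s, G.Adj a b → f a = f b ∨ G'.Adj (f a) (f b)) :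
    ∃ m, G'.WalkWithin (f '' s) m (f a) (f b) := by
  induction h with
  | nil ha => exact ⟨0, .nil ⟨_, ha, rfl⟩⟩
  | cons ha hab h ih =>
    obtain ⟨m, ih⟩ := ih
    rcases hf _ ha _ h.left_mem hab with h' | h'
    · exact ⟨m, h' ▸ ih⟩
    · exact ⟨m + 1, .cons ⟨_, ha, rfl⟩ h' ih⟩

end WalkWithin

/-- Any two vertices of `s` are joined by a walk within `s`. -/
def ConnectedWithin (G : SimpleGraph V) (s : Set V) : Prop :=
  ∀ a ∈ s, ∀ b ∈ s, ∃ n, G.WalkWithin s n a b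

theorem ConnectedWithin.of_base (r : V) (h : ∀ a ∈ s, ∃ n, G.WalkWithin s n a r) :
    G.ConnectedWithin s := fun a ha b hb ↦
  let ⟨_, hm⟩ := h a ha
  let ⟨_, hn⟩ := h b hb
  ⟨_, hm.trans hn.symm⟩

theorem induce_connected_iff_connectedWithin :
    (G.induce s).Connected ↔ s.Nonempty ∧ G.ConnectedWithin s := by
  rw [connected_iff, and_comm, Set.nonempty_coe_sort]
  refine and_congr_right fun _ ↦ ⟨fun h a ha b hb ↦ ?_, fun h a b ↦ ?_⟩
  · obtain ⟨p⟩ := h ⟨a, ha⟩ ⟨b, hb⟩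
    exact ⟨_, .of_walk_induce p⟩
  · obtain ⟨n, hn⟩ := h a a.2 b b.2
    exact ⟨hn.exists_walk_induce.choose⟩

theorem Connected.connectedWithin_univ (h : G.Connected) : G.ConnectedWithin Set.univ :=
  fun a _ b _ ↦ let ⟨p⟩ := h a b; ⟨_, .of_walk p⟩

theorem ConnectedWithin.image {f : V → V'} (h : G.ConnectedWithin s)
    (hf : ∀ a ∈ s, ∀ b ∈ s, G.Adj a b → f a = f b ∨ G'.Adj (f a) (f b)) :
    G'.ConnectedWithin (f '' s) := by
  rintro _ ⟨a, ha, rfl⟩ _ ⟨b, hb, rfl⟩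
  obtain ⟨n, hn⟩ := h a ha b hb
  exact hn.image hf

/-- In a connected set with at least two elements, every vertex has a neighbor. -/
theorem ConnectedWithin.exists_adj (h : G.ConnectedWithin s) (ha : a ∈ s) (hb : b ∈ s)
    (hab : a ≠ b) : ∃ d ∈ s, G.Adj a d := by
  obtain ⟨n, hn⟩ := h a ha b hb
  cases hn with
  | nil => exact absurd rfl hab
  | cons _ hab h => exact ⟨_, h.left_mem, hab⟩

/-! ### The common neighbor property -/

/-- Whenever two nonadjacent vertices of a connected subset `s` of `t` have a common neighbor in
`t`, they have one in `s`. -/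
def HasInducedCommonNeighbors (G : SimpleGraph V) (t : Set V) : Prop :=
  ∀ s ⊆ t, G.ConnectedWithin s → ∀ a ∈ s, ∀ b ∈ s, a ≠ b → ¬ G.Adj a b →
    ∀ c ∈ t, G.Adj a c → G.Adj c b → ∃ d ∈ s, G.Adj a d ∧ G.Adj d b

theorem HasInducedCommonNeighbors.congr {H : SimpleGraph V}
    (h : G.HasInducedCommonNeighbors t) (hGH : ∀ a ∈ t, ∀ b ∈ t, G.Adj a b ↔ H.Adj a b) :
    H.HasInducedCommonNeighbors t := by
  intro s hst hs a ha b hb hab hadj c hc hac hcb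
  have hs' : G.ConnectedWithin s := by
    have := hs.image (f := id) (G' := G)
      fun a ha b hb h ↦ .inr ((hGH a (hst ha) b (hst hb)).2 h)
    rwa [Set.image_id] at this
  obtain ⟨d, hd, had, hdb⟩ := h s hst hs' a ha b hb hab
    (by rwa [hGH a (hst ha) b (hst hb)]) c hc ((hGH a (hst ha) c hc).2 hac)
    ((hGH c hc b (hst hb)).2 hcb)
  exact ⟨d, hd, (hGH a (hst ha) d (hst hd)).1 had, (hGH d (hst hd) b (hst hb)).1 hdb⟩

theorem HasInducedCommonNeighbors.of_embedding {t' : Set V'}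
    (h : G'.HasInducedCommonNeighbors t') {f : V → V'} (hf : Function.Injective f)
    (hadj : ∀ a b, G'.Adj (f a) (f b) ↔ G.Adj a b) (hft : ∀ a ∈ t, f a ∈ t') :
    G.HasInducedCommonNeighbors t := by
  intro s hst hs a ha b hb hab hnadj c hc hac hcb
  obtain ⟨_, ⟨d, hd, rfl⟩, had, hdb⟩ := h (f '' s)
    (by rintro _ ⟨x, hx, rfl⟩; exact hft x (hst hx))
    (hs.image fun a _ b _ hab ↦ .inr ((hadj a b).2 hab)) (f a) ⟨a, ha, rfl⟩ (f b) ⟨b, hb, rfl⟩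
    (hf.ne hab) (by rwa [hadj]) (f c) (hft c hc) ((hadj _ _).2 hac) ((hadj _ _).2 hcb)
  exact ⟨d, hd, (hadj _ _).1 had, (hadj _ _).1 hdb⟩

/-- Adding a pendant vertex preserves the property. -/
theorem HasInducedCommonNeighbors.insert_pendant {u f : V}
    (h : G.HasInducedCommonNeighbors t) (hft : f ∉ t) (hadj : ∀ x ∈ t, G.Adj f x ↔ x = u) :
    G.HasInducedCommonNeighbors (insert f t) := by
  classical
  have hfu : ∀ x ∈ insert f t, G.Adj f x → x = u := by
    rintro x (rfl | hx) hfx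
    · exact absurd hfx (G.irrefl)
    · exact (hadj x hx).1 hfx
  intro s hst hs a ha b hb hab hnadj c hc hac hcb
  have hcf : c ≠ f := by
    rintro rfl
    exact hab ((hfu a (hst ha) hac.symm).trans (hfu b (hst hb) hcb).symm)
  have hct : c ∈ t := hc.resolve_left hcf
  by_cases hfs : f ∈ s
  · have hus : u ∈ s := by
      -- A second vertex of `s` forces `f` to have a neighbor in `s`, which can only be `u`.
      obtain ⟨x, hx, hxf⟩ : ∃ x ∈ s, x ≠ f := by
        by_cases haf : a = f
        · exact ⟨b, hb, fun hbf ↦ hab (haf.trans hbf.symm)⟩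
        · exact ⟨a, ha, haf⟩
      obtain ⟨d, hd, hfd⟩ := hs.exists_adj hfs hx hxf.symm
      exact hfu d (hst hd) hfd ▸ hd
    by_cases haf : a = f
    · subst haf
      obtain rfl := hfu c hc hac
      exact ⟨c, hus, hac, hcb⟩
    by_cases hbf : b = f
    · subst hbf
      obtain rfl := hfu c hc hcb.symm
      exact ⟨c, hus, hac, hcb⟩
    have huf : u ≠ f := by
      rintro rfl
      obtain ⟨d, hd, hfd⟩ := hs.exists_adj hfs ha (Ne.symm haf)
      exact G.ne_of_adj hfd (hfu d (hst hd) hfd).symm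
    -- Folding the pendant vertex onto `u` retracts `s` to `s \ {f}`, which is therefore connected.
    have himg : (fun x ↦ if x = f then u else x) '' s = s \ {f} := by
      ext x
      constructor
      · rintro ⟨y, hy, rfl⟩
        by_cases hyf : y = f <;> simp [hyf, hus, huf, hy]
      · rintro ⟨hx, hxf⟩
        exact ⟨x, hx, if_neg hxf⟩
    have hconn : G.ConnectedWithin (s \ {f}) := by
      rw [← himg]
      refine hs.image fun x hx y hy hxy ↦ ?_
      by_cases hxf : x = f
      · subst hxf
        obtain rfl := hfu y (hst hy) hxy
        simp
      · by_cases hyf : y = f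
        · subst hyf
          obtain rfl := hfu x (hst hx) hxy.symm
          simp
        · simp [hxf, hyf, hxy]
    obtain ⟨d, hd, h'⟩ := h (s \ {f}) (fun x hx ↦ (hst hx.1).resolve_left hx.2) hconn a ⟨ha, haf⟩
      b ⟨hb, hbf⟩ hab hnadj c hct hac hcb
    exact ⟨d, hd.1, h'⟩
  · exact h s (fun x hx ↦ (hst hx).resolve_left fun hxf ↦ hfs (hxf ▸ hx)) hs a ha b hb hab hnadj
      c hct hac hcb

/-- Adding a false twin preserves the property. -/
theorem HasInducedCommonNeighbors.insert_twin {u f : V}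
    (h : G.HasInducedCommonNeighbors t) (hut : u ∈ t) (hft : f ∉ t)
    (hadj : ∀ x ∈ t, G.Adj f x ↔ G.Adj u x) :
    G.HasInducedCommonNeighbors (insert f t) := by
  classical
  have hfu : ∀ x ∈ insert f t, G.Adj f x ↔ G.Adj u x := by
    rintro x (rfl | hx)
    · simp [G.adj_comm u, hadj u hut]
    · exact hadj x hx
  -- Folding `f` onto its twin preserves and reflects adjacency, so the whole configuration can be
  -- moved into `t`.
  set π : V → V := fun x ↦ if x = f then u else x with hπ
  have hπadj : ∀ x ∈ insert f t, ∀ y ∈ insert f t, (G.Adj (π x) (π y) ↔ G.Adj x y) := by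
    intro x hx y hy
    by_cases hxf : x = f <;> by_cases hyf : y = f
    · simp [hπ, hxf, hyf]
    · simp [hπ, hxf, hyf, hfu y hy]
    · simp [hπ, hxf, hyf, G.adj_comm x, hfu x hx]
    · simp [hπ, hxf, hyf]
  have hπt : ∀ x ∈ insert f t, π x ∈ t := by
    rintro x (rfl | hx)
    · simpa [hπ]
    · have : x ≠ f := fun hxf ↦ hft (hxf ▸ hx)
      simpa [hπ, this]
  intro s hst hs a ha b hb hab hnadj c hc hac hcb
  by_cases hne : π a = π b
  · -- here `a` and `b` are `u` and `f`, and any neighbor in `s` is common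
    obtain ⟨d, hd, had⟩ := hs.exists_adj ha hb hab
    refine ⟨d, hd, had, ?_⟩
    rw [← hπadj d (hst hd) b (hst hb), ← hne, hπadj d (hst hd) a (hst ha)]
    exact had.symm
  · obtain ⟨_, ⟨d, hd, rfl⟩, h1, h2⟩ := h (π '' s)
      (by rintro _ ⟨x, hx, rfl⟩; exact hπt x (hst hx))
      (hs.image fun x hx y hy hxy ↦ .inr ((hπadj x (hst hx) y (hst hy)).2 hxy))
      (π a) ⟨a, ha, rfl⟩ (π b) ⟨b, hb, rfl⟩ hne (by rwa [hπadj a (hst ha) b (hst hb)])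
      (π c) (hπt c hc) ((hπadj a (hst ha) c hc).2 hac) ((hπadj c hc b (hst hb)).2 hcb)
    exact ⟨d, hd, (hπadj _ (hst ha) _ (hst hd)).1 h1, (hπadj _ (hst hd) _ (hst hb)).1 h2⟩

/-- Under the common neighbor property, connected sets are isometric. -/
theorem HasInducedCommonNeighbors.exists_walkWithin_le
    (h : G.HasInducedCommonNeighbors Set.univ) (p : G.Walk a b) :
    ∀ s : Set V, G.ConnectedWithin s → a ∈ s → b ∈ s → ∃ m ≤ p.length, G.WalkWithin s m a b := by
  induction p with
  | nil => exact fun s _ ha _ ↦ ⟨0, le_rfl, .nil ha⟩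
  | @cons a c b hac p ih =>
    intro s hs ha hb
    by_cases hc : c ∈ s
    · obtain ⟨m, hm, hw⟩ := ih s hs hc hb
      exact ⟨m + 1, by simpa using hm, .cons ha hac hw⟩
    -- When the walk leaves `s` at `c`, induct in `insert c s` and keep the tail after the last
    -- visit to `c`, starting at `d`. Both `a` and `d` are neighbors of `c`, so at most two steps
    -- within `s` lead from `a` to `d`, no more than the detour through `c`.
    have hs' : G.ConnectedWithin (insert c s) := by
      refine .of_base a ?_
      rintro x (rfl | hx)
      · exact ⟨1, .of_adj (.inl rfl) (.inr ha) hac.symm⟩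
      · exact (hs x hx a ha).imp fun _ h ↦ h.mono (Set.subset_insert _ _)
    obtain ⟨m, hm, hw⟩ := ih _ hs' (.inl rfl) (.inr hb)
    rcases hw.avoid_or_exists_tail hb with hw | ⟨d, hd, hcd, k, hk, hw⟩
    · exact absurd hw.left_mem hc
    by_cases had : a = d
    · subst had
      exact ⟨k, by simp; omega, hw⟩
    by_cases hadj : G.Adj a d
    · exact ⟨k + 1, by simp; omega, .cons ha hadj hw⟩
    obtain ⟨e, he, hae, hed⟩ := h s (Set.subset_univ s) hs a ha d hd had hadj c trivial hac hcd
    exact ⟨k + 1 + 1, by simp; omega, .cons ha hae (.cons he hed hw)⟩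

end SimpleGraph

/-! ### Distance heredity as a local condition -/

open SimpleGraph

variable {V : Type*} {G : SimpleGraph V}

/-- A common neighbor in `s` is a path of length two in the induced subgraph, so the condition says
that distance two is inherited; iterating along a shortest path gives all distances. -/
theorem isDistanceHereditary_iff_hasInducedCommonNeighbors :
    IsDistanceHereditary G ↔ G.HasInducedCommonNeighbors Set.univ := by
  constructor
  · intro h s _ hs a ha b hb hab hadj c _ hac hcb
    have hconn := induce_connected_iff_connectedWithin.2 ⟨⟨a, ha⟩, hs⟩
    obtain ⟨p, hp⟩ := hconn.exists_walk_length_eq_dist ⟨a, ha⟩ ⟨b, hb⟩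
    rw [h s hconn] at hp
    have hle : p.length ≤ 2 := hp ▸ G.dist_le (.cons hac (.cons hcb .nil))
    have hw := WalkWithin.of_walk_induce p
    generalize p.length = n at hle hw
    -- Distinct nonadjacent ends exclude lengths 0 and 1, so the middle vertex of a walk of length 2
    -- is the common neighbor.
    cases hw with
    | nil => exact absurd rfl hab
    | @cons n _ d _ _ had hw =>
      cases hw with
      | nil => exact absurd had hadj
      | @cons n _ e _ hd hde hw =>
        obtain rfl : n = 0 := by omega
        cases hw
        exact ⟨d, hd, had, hde⟩
  · intro h s hconn x y
    have hs := (induce_connected_iff_connectedWithin.1 hconn).2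
    have hreach : G.Reachable x y := by
      obtain ⟨n, hn⟩ := hs x x.2 y y.2
      exact ⟨hn.exists_walk.choose⟩
    obtain ⟨p, hp⟩ := hreach.exists_walk_length_eq_dist
    obtain ⟨m, hm, hw⟩ := h.exists_walkWithin_le p s hs x.2 y.2
    obtain ⟨q, hq⟩ := hw.exists_walk_induce
    obtain ⟨q', hq'⟩ := hconn.exists_walk_length_eq_dist x y
    obtain ⟨r, hr⟩ := (WalkWithin.of_walk_induce q').exists_walk
    apply le_antisymm
    · have := (G.induce s).dist_le q
      simp only [Subtype.coe_eta] at this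
      omega
    · have := G.dist_le r
      omega

end

/-! ### Pendant vertices and false twins in the distance layers -/

namespace SimpleGraph

variable {V : Type*} {G : SimpleGraph V} {a b r : V}

theorem Connected.exists_adj_dist_add_one (h : G.Connected) (ha : G.dist r a ≠ 0) :
    ∃ b, G.Adj a b ∧ G.dist r b + 1 = G.dist r a := by
  obtain ⟨p, hp⟩ := h.exists_walk_length_eq_dist a r
  rw [dist_comm] at hp
  cases p with
  | nil => simp at ha
  | @cons _ b _ hab p =>
    refine ⟨b, hab, ?_⟩
    have h1 := G.dist_le p
    have h2 := hab.diff_dist_adj (u := r)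
    rw [dist_comm] at h1
    rw [Walk.length_cons] at hp
    omega

/-- By two-colorability, distances from `r` to adjacent vertices have different parity, so they
cannot be equal. -/
theorem Connected.dist_add_one_of_adj_of_le (h : G.Connected) (c : G.Coloring Bool)
    (hab : G.Adj a b) (hle : G.dist r b ≤ G.dist r a) : G.dist r b + 1 = G.dist r a := by
  obtain ⟨p, hp⟩ := h.exists_walk_length_eq_dist r a
  obtain ⟨q, hq⟩ := h.exists_walk_length_eq_dist r b
  have h1 := c.even_length_iff_congr p
  have h2 := c.even_length_iff_congr q
  have h3 := c.valid hab
  have h4 := hab.diff_dist_adj (u := r)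
  have hne : G.dist r a ≠ G.dist r b := by
    intro heq
    rw [hp, heq] at h1
    rw [hq] at h2
    generalize c r = i at h1 h2
    generalize c a = j at h1 h3
    generalize c b = k at h2 h3
    rw [h1] at h2
    revert h2 h3
    cases i <;> cases j <;> cases k <;> simp
  omega

/-- Balls are connected. -/
theorem Connected.exists_walkWithin_of_dist_le (h : G.Connected) {s : Set V} {m : ℕ}
    (hs : ∀ x, G.dist r x ≤ m → x ∈ s) (ha : G.dist r a ≤ m) : ∃ n, G.WalkWithin s n a r := by
  induction hn : G.dist r a generalizing a with
  | zero =>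
    obtain rfl := (h.dist_eq_zero_iff).1 hn
    exact ⟨0, .nil (hs _ ha)⟩
  | succ n ih =>
    obtain ⟨b, hab, hb⟩ := h.exists_adj_dist_add_one (r := r) (a := a) (by omega)
    obtain ⟨k, hk⟩ := ih (a := b) (by omega) (by omega)
    exact ⟨k + 1, .cons (hs _ ha) hab hk⟩

/-- A finite connected bipartite graph with the common neighbor property has a pendant vertex or
a pair of false twins. -/
theorem HasInducedCommonNeighbors.exists_pendant_or_twin [Finite V] [Nontrivial V]
    (h : G.HasInducedCommonNeighbors Set.univ) (hconn : G.Connected) (c : G.Coloring Bool) :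
    ∃ u v, u ≠ v ∧ ((∀ x, G.Adj v x ↔ x = u) ∨ ∀ x, G.Adj v x ↔ G.Adj u x) := by
  obtain ⟨r⟩ := hconn.nonempty
  obtain ⟨v₀, hv₀⟩ := Finite.exists_max (G.dist r)
  -- Among the vertices farthest from `r`, take one of least degree; this minimality gives the
  -- nesting of neighborhoods in `hnest`.
  obtain ⟨v, hv, hmin⟩ := Set.exists_min_image {v | G.dist r v = G.dist r v₀}
    (fun v ↦ (G.neighborSet v).ncard) (Set.toFinite _) ⟨v₀, rfl⟩
  generalize hk : G.dist r v₀ = k at *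
  simp only [Set.mem_ofPred_eq] at hv hmin
  have hpred : ∀ w x, G.dist r w = k → G.Adj w x → G.dist r x + 1 = k := fun w x hw hwx ↦
    hw ▸ hconn.dist_add_one_of_adj_of_le c hwx (hw ▸ hv₀ x)
  -- The test sets below consist of the ball of radius `k - 2` and a few vertices of the last two
  -- layers. The ball is connected and reached from layer `k - 1` in one step.
  have hbase : ∀ {s : Set V}, (∀ x, G.dist r x ≤ k - 2 → x ∈ s) → 2 ≤ k → ∀ x,
      x ∈ s → G.dist r x + 1 = k → ∃ n, G.WalkWithin s n x r := by
    intro s hs hk2 x hx hxk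
    obtain ⟨z, hxz, hz⟩ := hconn.exists_adj_dist_add_one (r := r) (a := x) (by omega)
    obtain ⟨n, hn⟩ := hconn.exists_walkWithin_of_dist_le hs (a := z) (by omega)
    exact ⟨n + 1, .cons hx hxz hn⟩
  have hunique : ∀ x y, x ≠ y → G.dist r x + 1 = k → G.dist r y + 1 = k → 2 ≤ k := by
    intro x y hxy hx hy
    by_contra hk2
    exact hxy (((hconn.dist_eq_zero_iff).1 (by omega)).symm.trans
      ((hconn.dist_eq_zero_iff).1 (by omega : G.dist r y = 0)))
  -- If a last-layer vertex `w` shares the neighbor `x` with `v` but misses the neighbor `y` of `v`,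
  -- then by minimality it has a neighbor `t` outside that of `v`. The ball with `y`, `t`, `v`, `w`
  -- is connected, yet contains no common neighbor of `v` and `w`.
  have hnest : ∀ w, G.dist r w = k → ∀ x, G.Adj v x → G.Adj w x → ∀ y, G.Adj v y → G.Adj w y := by
    intro w hw x hvx hwx y hvy
    by_contra hwy
    obtain ⟨t, hwt, hvt⟩ : ∃ t, G.Adj w t ∧ ¬ G.Adj v t := by
      by_contra! hsub
      have hlt : (G.neighborSet w).ncard < (G.neighborSet v).ncard :=
        Set.ncard_lt_ncard ⟨fun t ht ↦ hsub t ht, fun hsup ↦ hwy (hsup hvy)⟩ (Set.toFinite _)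
      exact absurd (hmin w hw) (not_le.2 hlt)
    have hk2 := hunique x y (by rintro rfl; exact hwy hwx) (hpred v x hv hvx) (hpred v y hv hvy)
    set s : Set V := {z | G.dist r z ≤ k - 2 ∨ z = y ∨ z = t ∨ z = v ∨ z = w} with hs
    have hsb : ∀ x, G.dist r x ≤ k - 2 → x ∈ s := fun x hx ↦ .inl hx
    have hys : y ∈ s := by simp [hs]
    have hts : t ∈ s := by simp [hs]
    have hvs : v ∈ s := by simp [hs]
    have hws : w ∈ s := by simp [hs]
    have hyr := hbase hsb hk2 y hys (hpred v y hv hvy)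
    have htr := hbase hsb hk2 t hts (hpred w t hw hwt)
    have hsc : G.ConnectedWithin s := by
      refine .of_base r ?_
      rintro z (hz | rfl | rfl | rfl | rfl)
      · exact hconn.exists_walkWithin_of_dist_le hsb hz
      · exact hyr
      · exact htr
      · exact hyr.imp' _ fun _ hn ↦ .cons hvs hvy hn
      · exact htr.imp' _ fun _ hn ↦ .cons hws hwt hn
    obtain ⟨d, hd, hvd, hdw⟩ := h s (Set.subset_univ s) hsc v hvs w hws
      (by rintro rfl; exact hwy hvy) (fun hvw ↦ by have := hpred v w hv hvw; omega) x trivial hvx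
      hwx.symm
    have hdk := hpred v d hv hvd
    rcases hd with hd | rfl | rfl | rfl | rfl
    · omega
    · exact hwy hdw.symm
    · exact hvt hvd
    · exact G.irrefl hvd
    · exact G.irrefl hdw
  obtain ⟨u, hvu⟩ : ∃ u, G.Adj v u := by
    obtain ⟨w, hw⟩ := exists_ne v
    obtain ⟨u, -, hu⟩ := hconn.connectedWithin_univ.exists_adj (Set.mem_univ v) (Set.mem_univ w)
      hw.symm
    exact ⟨u, hu⟩
  by_cases hpend : ∀ y, G.Adj v y → y = u
  · exact ⟨u, v, hvu.ne', .inl fun x ↦ ⟨hpend x, fun hx ↦ hx ▸ hvu⟩⟩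
  push Not at hpend
  obtain ⟨y, hvy, hyu⟩ := hpend
  -- Any two neighbors of `v` are twins. Their neighbors in layer `k` agree by `hnest`; for `z` in
  -- layer `k - 2`, the only neighbor of `v` in the ball with `y` and `v` is `y`, so `y` is the
  -- common neighbor of `v` and `z`.
  have key : ∀ x y, x ≠ y → G.Adj v x → G.Adj v y → ∀ z, G.Adj x z → G.Adj y z := by
    intro x y hxy hvx hvy z hxz
    have hx := hpred v x hv hvx
    by_cases hz : G.dist r z = k
    · exact (hnest z hz x hvx hxz.symm y hvy).symm
    have hzx : G.dist r z + 1 = G.dist r x := by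
      have := hxz.diff_dist_adj (u := r)
      exact hconn.dist_add_one_of_adj_of_le c hxz (by omega)
    have hk2 : 2 ≤ k := by omega
    set s : Set V := {z | G.dist r z ≤ k - 2 ∨ z = y ∨ z = v} with hs
    have hsb : ∀ x, G.dist r x ≤ k - 2 → x ∈ s := fun x hx ↦ .inl hx
    have hys : y ∈ s := by simp [hs]
    have hvs : v ∈ s := by simp [hs]
    have hyr := hbase hsb hk2 y hys (hpred v y hv hvy)
    have hsc : G.ConnectedWithin s := by
      refine .of_base r ?_
      rintro z (hz | rfl | rfl)
      · exact hconn.exists_walkWithin_of_dist_le hsb hz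
      · exact hyr
      · exact hyr.imp' _ fun _ hn ↦ .cons hvs hvy hn
    obtain ⟨d, hd, hvd, hdz⟩ := h s (Set.subset_univ s) hsc v hvs z (hsb z (by omega))
      (by rintro rfl; exact hz hv) (fun hvz ↦ by have := hpred v z hv hvz; omega) x trivial hvx hxz
    have hdk := hpred v d hv hvd
    rcases hd with hd | rfl | rfl
    · omega
    · exact hdz
    · exact absurd hvd G.irrefl
  exact ⟨u, y, hyu.symm, .inr fun x ↦ ⟨key y u hyu hvy hvu x, key u y hyu.symm hvu hvy x⟩⟩

end SimpleGraph

/-! ### Reachability along edge sets of a multigraph -/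

section

namespace Graph

variable {α β : Type*} {S : Graph α β} {A B T : Set β} {a b x y : α} {e f g : β}

/-- `a` and `b` are joined by a walk of `S` all of whose edges lie in `A`. -/
def ConnectedBy (S : Graph α β) (A : Set β) : α → α → Prop :=
  Relation.ReflTransGen fun x y ↦ ∃ g ∈ A, S.IsLink g x y

namespace ConnectedBy

@[refl] protected theorem refl (S : Graph α β) (A : Set β) (a : α) : S.ConnectedBy A a a :=
  Relation.ReflTransGen.refl

theorem trans {c : α} (h : S.ConnectedBy A a b) (h' : S.ConnectedBy A b c) :
    S.ConnectedBy A a c := Relation.ReflTransGen.trans h h'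

theorem of_isLink (hg : g ∈ A) (h : S.IsLink g a b) : S.ConnectedBy A a b := .single ⟨g, hg, h⟩

theorem symm (h : S.ConnectedBy A a b) : S.ConnectedBy A b a := by
  induction h with
  | refl => rfl
  | tail _ h ih =>
    obtain ⟨g, hg, h⟩ := h
    exact (of_isLink hg h.symm).trans ih

/-- Change of graph along a vertex map, replacing each edge by a walk. -/
theorem lift {α' β' : Type*} {S' : Graph α' β'} {A' : Set β'} (π : α → α')
    (hπ : ∀ g ∈ A, ∀ x y, S.IsLink g x y → S'.ConnectedBy A' (π x) (π y))
    (h : S.ConnectedBy A a b) : S'.ConnectedBy A' (π a) (π b) := by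
  induction h with
  | refl => rfl
  | tail _ h ih =>
    obtain ⟨g, hg, h⟩ := h
    exact ih.trans (hπ g hg _ _ h)

theorem mono (hAB : A ⊆ B) (h : S.ConnectedBy A a b) : S.ConnectedBy B a b :=
  h.lift id fun _ hg _ _ h ↦ of_isLink (hAB hg) h

/-- A vertex not incident with `A` is isolated. -/
theorem eq_of_forall_not_isLink (h : S.ConnectedBy A a b)
    (ha : ∀ g ∈ A, ∀ c, ¬ S.IsLink g a c) : a = b := by
  rcases Relation.ReflTransGen.cases_head h with h | ⟨c, ⟨g, hg, h⟩, -⟩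
  · exact h
  · exact absurd h (ha g hg c)

/-- The truth of `ConnectedBy` for the two ends of an edge does not depend on their order. -/
theorem congr_isLink (hxy : S.IsLink e x y) (hab : S.IsLink e a b) :
    S.ConnectedBy A x y ↔ S.ConnectedBy A a b := by
  rcases hxy.eq_and_eq_or_eq_and_eq hab with ⟨rfl, rfl⟩ | ⟨rfl, rfl⟩
  · rfl
  · exact ⟨symm, symm⟩

end ConnectedBy

theorem toSimpleGraph_connected_iff :
    S.toSimpleGraph.Connected ↔
      V(S).Nonempty ∧ ∀ a ∈ V(S), ∀ b ∈ V(S), S.ConnectedBy Set.univ a b := by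
  rw [SimpleGraph.connected_iff, and_comm, Set.nonempty_coe_sort]
  refine and_congr_right fun _ ↦ ⟨fun h a ha b hb ↦ ?_, fun h a b ↦ ?_⟩
  · obtain ⟨p⟩ := h ⟨a, ha⟩ ⟨b, hb⟩
    have key : ∀ x y : V(S), ∀ p : S.toSimpleGraph.Walk x y, S.ConnectedBy Set.univ x y := by
      intro x y p
      induction p with
      | nil => rfl
      | cons h p ih =>
        obtain ⟨g, hg⟩ := (toSimpleGraph_adj _ _ _ ▸ h).2
        exact (ConnectedBy.of_isLink (Set.mem_univ g) hg).trans ih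
    exact key _ _ p
  · obtain ⟨a, ha⟩ := a
    obtain ⟨b, hb⟩ := b
    have hab := h a ha b hb
    induction hab with
    | refl => rfl
    | @tail c d _ hcd ih =>
      obtain ⟨g, -, hg⟩ := hcd
      refine (ih hg.left_mem).trans ?_
      by_cases hne : c = d
      · subst hne; rfl
      · refine SimpleGraph.Adj.reachable ?_
        rw [toSimpleGraph_adj]
        exact ⟨by simpa using hne, g, hg⟩

theorem restrict_toSimpleGraph_connected_iff :
    (S.restrict A).toSimpleGraph.Connected ↔
      V(S).Nonempty ∧ ∀ a ∈ V(S), ∀ b ∈ V(S), S.ConnectedBy A a b := by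
  rw [toSimpleGraph_connected_iff, vertexSet_restrict]
  refine and_congr_right fun _ ↦ forall₂_congr fun a _ ↦ forall₂_congr fun b _ ↦
    ⟨fun h ↦ h.lift id fun g _ x y hxy ↦ ?_, fun h ↦ h.lift id fun g hg x y hxy ↦ ?_⟩
  · rw [restrict_isLink] at hxy
    exact .of_isLink hxy.1 hxy.2
  · refine .of_isLink (g := g) trivial ?_
    rw [restrict_isLink]
    exact ⟨hg, hxy⟩

theorem deleteVerts_toSimpleGraph_connected_iff {v : α} :
    (S.deleteVerts {v}).toSimpleGraph.Connected ↔
      (V(S) \ {v}).Nonempty ∧ ∀ a ∈ V(S), a ≠ v → ∀ b ∈ V(S), b ≠ v →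
        S.ConnectedBy {g | ¬ S.Inc g v} a b := by
  rw [toSimpleGraph_connected_iff, vertexSet_deleteVerts]
  refine and_congr_right fun _ ↦ ⟨fun h a ha hav b hb hbv ↦ ?_, fun h a ha b hb ↦ ?_⟩
  · refine (h a ⟨ha, hav⟩ b ⟨hb, hbv⟩).lift id fun g _ x y hxy ↦ ?_
    rw [deleteVerts_isLink] at hxy
    refine .of_isLink (fun hgv ↦ ?_) hxy.1
    rcases hgv.eq_or_eq_of_isLink hxy.1 with rfl | rfl <;> simp at hxy
  · refine (h a ha.1 ha.2 b hb.1 hb.2).lift id fun g hg x y hxy ↦ .of_isLink (g := g) trivial ?_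
    rw [deleteVerts_isLink]
    refine ⟨hxy, ?_, ?_⟩
    · rintro rfl
      exact hg hxy.inc_left
    · rintro rfl
      exact hg hxy.inc_right

end Graph

/-! ### Cycles, spanning trees and fundamental cycles -/

variable {α β : Type*} {S : Graph α β} {A C T : Set β} {x y : α} {e f g : β}

/-- The ends of an edge of a cycle are joined by the rest of the cycle. -/
theorem IsCycleEdgeSet.connectedBy_diff (hC : IsCycleEdgeSet S C) (hg : g ∈ C)
    (hxy : S.IsLink g x y) : S.ConnectedBy (C \ {g}) x y := by
  obtain ⟨n, v, e, -, he, hlink, rfl⟩ := hC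
  obtain ⟨j, rfl⟩ := hg
  rw [Graph.ConnectedBy.congr_isLink hxy (hlink j).symm]
  -- Walk around the cycle from the far end of edge `j`; the first `n` steps avoid edge `j`, and
  -- step `n` arrives at its near end.
  have key : ∀ k : ℕ, k ≤ n →
      S.ConnectedBy (Set.range e \ {e j}) (v (j + 1)) (v (j + 1 + (Fin.ofNat (n + 1) k))) := by
    intro k
    induction k with
    | zero => intro _; simp; rfl
    | succ k ih =>
      intro hk
      refine (ih (by omega)).trans (.of_isLink (g := e (j + 1 + Fin.ofNat (n + 1) k)) ?_ ?_)
      · refine ⟨⟨_, rfl⟩, fun h ↦ ?_⟩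
        have h := he h
        rw [add_assoc, add_eq_left] at h
        have h := congrArg Fin.val h
        simp [Fin.val_add, Nat.mod_eq_of_lt (by omega : 1 + k < n + 1)] at h
      · have hk' : Fin.ofNat (n + 1) (k + 1) = Fin.ofNat (n + 1) k + 1 := by
          ext
          simp [Fin.val_add]
        rw [hk', ← add_assoc]
        exact hlink _
  convert key n le_rfl using 2
  rw [add_assoc, eq_comm, add_eq_left]
  ext
  simp [Fin.val_add, Nat.add_comm 1 n]

/-- An edge whose ends are joined by edges of `A` lies on a cycle using only further edges
of `A`. -/
theorem exists_isCycleEdgeSet (hA : S.ConnectedBy A x y) (hxy : S.IsLink g x y) (hg : g ∉ A) :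
    ∃ C, IsCycleEdgeSet S C ∧ C ⊆ insert g A ∧ g ∈ C := by
  classical
  let H : SimpleGraph α := SimpleGraph.fromRel fun a b ↦ ∃ e ∈ A, S.IsLink e a b
  have hH : ∀ a b, H.Adj a b → ∃ e ∈ A, S.IsLink e a b := by
    rintro a b ⟨-, h | ⟨e, he, h⟩⟩
    · exact h
    · exact ⟨e, he, h.symm⟩
  have hreach : H.Reachable x y := by
    clear hxy
    induction hA with
    | refl => rfl
    | @tail b c _ h ih =>
      refine ih.trans ?_
      by_cases hbc : b = c
      · subst hbc; rfl
      · exact SimpleGraph.Adj.reachable ⟨hbc, .inl h⟩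
  obtain ⟨p, hp⟩ := hreach.exists_isPath
  have hinj : ∀ i j, i ≤ p.length → j ≤ p.length → p.getVert i = p.getVert j → i = j :=
    fun i j hi hj h ↦ hp.getVert_injOn hi hj h
  have hedge : ∀ i : ℕ, ∃ e, i < p.length →
      e ∈ A ∧ S.IsLink e (p.getVert i) (p.getVert (i + 1)) := by
    intro i
    by_cases hi : i < p.length
    · obtain ⟨e, he⟩ := hH _ _ (p.adj_getVert_succ hi)
      exact ⟨e, fun _ ↦ he⟩
    · exact ⟨g, fun h ↦ absurd h hi⟩
  choose e he using hedge
  -- The last index carries the closing edge `g`, where the successor wraps to 0. For a loop `g` the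
  -- path is trivial and the cycle has length one.
  let e' : Fin (p.length + 1) → β := fun i ↦ if (i : ℕ) < p.length then e i else g
  refine ⟨Set.range e', ⟨p.length, fun i ↦ p.getVert i, e', ?_, ?_, ?_, rfl⟩, ?_, ?_⟩
  · exact fun i j h ↦ Fin.ext (hinj i j (by omega) (by omega) h)
  · intro i j hij
    apply Fin.ext
    simp only [e'] at hij
    split_ifs at hij with hi hj hj
    · have hli := (he i hi).2
      have hlj := (he j hj).2
      rw [hij] at hli
      -- A repeated label repeats its ends; in the crossed order this would give `i = j + 1` and `i
      -- + 1 = j`.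
      rcases hli.eq_and_eq_or_eq_and_eq hlj with ⟨h, -⟩ | ⟨h, h'⟩
      · exact hinj _ _ (by omega) (by omega) h
      · have h := hinj _ _ (by omega) (by omega) h
        have h' := hinj _ _ (by omega) (by omega) h'
        omega
    · exact absurd (hij ▸ (he i hi).1) hg
    · exact absurd (hij ▸ (he j hj).1) hg
    · omega
  · intro i
    simp only [e']
    split_ifs with hi
    · have : ((i + 1 : Fin (p.length + 1)) : ℕ) = i + 1 := by
        rw [Fin.val_add_one_of_lt']
        omega
      rw [this]
      exact (he i hi).2
    · have hi' : i = Fin.last p.length := Fin.ext (by simp; omega)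
      subst hi'
      simpa using hxy.symm
  · rintro _ ⟨i, rfl⟩
    simp only [e']
    split_ifs with hi
    · exact .inr (he i hi).1
    · exact .inl rfl
  · exact ⟨Fin.last _, by simp [e']⟩

theorem IsSpanningTree.connectedBy (hT : IsSpanningTree S T) {a b : α} (ha : a ∈ V(S))
    (hb : b ∈ V(S)) : S.ConnectedBy T a b :=
  (Graph.restrict_toSimpleGraph_connected_iff.1 hT.connected).2 a ha b hb

theorem IsSpanningTree.not_connectedBy_diff (hT : IsSpanningTree S T) (hg : g ∈ T)
    (hxy : S.IsLink g x y) : ¬ S.ConnectedBy (T \ {g}) x y := by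
  intro h
  obtain ⟨C, hC, hCT, -⟩ := exists_isCycleEdgeSet h hxy (by simp)
  refine hT.acyclic C (hCT.trans ?_) hC
  simp [hg]

/-- A criterion without cycles: it is enough that each edge of `T` is a bridge of `T`, since any
edge of a cycle is bypassed by the rest of it. -/
theorem IsSpanningTree.of_connectedBy (hsub : T ⊆ E(S)) (hne : V(S).Nonempty)
    (hconn : ∀ a ∈ V(S), ∀ b ∈ V(S), S.ConnectedBy T a b)
    (hT : ∀ g ∈ T, ∃ x y, S.IsLink g x y ∧ ¬ S.ConnectedBy (T \ {g}) x y) :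
    IsSpanningTree S T where
  subset := hsub
  connected := Graph.restrict_toSimpleGraph_connected_iff.2 ⟨hne, hconn⟩
  acyclic C hCT hC := by
    obtain ⟨g, hg⟩ : C.Nonempty := by
      obtain ⟨n, v, e, -, -, -, rfl⟩ := hC
      exact Set.range_nonempty e
    obtain ⟨x, y, hxy, h⟩ := hT g (hCT hg)
    exact h ((hC.connectedBy_diff hg hxy).mono (Set.sdiff_subset_sdiff_left hCT))

/-- A tree edge `e` lies on the fundamental cycle of `f` exactly when its removal from the tree
separates the ends of `f`. -/
theorem IsSpanningTree.memFundamentalCycle_iff (hT : IsSpanningTree S T) (he : e ∈ T) (hf : f ∉ T)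
    (hxy : S.IsLink f x y) : MemFundamentalCycle S T f e ↔ ¬ S.ConnectedBy (T \ {e}) x y := by
  constructor
  · rintro ⟨C, hC, hCT, heC⟩ h
    obtain ⟨a, b, hab⟩ := Graph.exists_isLink_of_mem_edgeSet (hT.subset he)
    -- The cycle without `e` joins the ends of `e`; rerouting its possible edge `f` through `T \
    -- {e}` would bypass the tree edge `e` inside the tree.
    refine hT.not_connectedBy_diff he hab ((hC.connectedBy_diff heC hab).lift id ?_)
    rintro g ⟨hgC, hge⟩ c d hcd
    rcases hCT hgC with rfl | hgT
    · exact (Graph.ConnectedBy.congr_isLink hxy hcd).1 h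
    · exact .of_isLink ⟨hgT, hge⟩ hcd
  · intro h
    obtain ⟨C, hC, hCT, hfC⟩ := exists_isCycleEdgeSet
      (hT.connectedBy hxy.left_mem hxy.right_mem) hxy hf
    refine ⟨C, hC, hCT, ?_⟩
    by_contra heC
    refine h ((hC.connectedBy_diff hfC hxy).mono ?_)
    rintro g ⟨hgC, hgf⟩
    exact ⟨(hCT hgC).resolve_left hgf, fun hge ↦ heC (hge ▸ hgC)⟩

end

/-! ### Fundamental graphs under parallel and series extension -/

section

variable {α β : Type*} {S S' : Graph α β} {A C T T' : Set β} {a b p q x y w : α} {e f g k : β}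

/-- The adjacency of the fundamental graph, as a simple graph on the type of all edge labels. -/
def fundamentalAdj (S : Graph α β) (T : Set β) : SimpleGraph β where
  Adj a b := (a ∈ T ∧ b ∉ T ∧ MemFundamentalCycle S T b a) ∨
    (b ∈ T ∧ a ∉ T ∧ MemFundamentalCycle S T a b)
  symm := ⟨fun _ _ h => h.symm⟩
  loopless := ⟨fun _ h => h.elim (fun h => h.2.1 h.1) (fun h => h.2.1 h.1)⟩

theorem fundamentalAdj_mem_iff (h : (fundamentalAdj S T).Adj g k) : g ∈ T ↔ k ∉ T := by
  rcases h with h | h <;> tauto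

theorem fundamentalAdj_iff_of_mem (hg : g ∈ T) (hk : k ∉ T) :
    (fundamentalAdj S T).Adj g k ↔ MemFundamentalCycle S T k g := by
  simp [fundamentalAdj, hg, hk]

theorem IsSpanningTree.fundamentalAdj_iff (hT : IsSpanningTree S T) (hg : g ∈ T) (hk : k ∉ T)
    (hxy : S.IsLink k x y) :
    (fundamentalAdj S T).Adj g k ↔ ¬ S.ConnectedBy (T \ {g}) x y := by
  rw [fundamentalAdj_iff_of_mem hg hk, hT.memFundamentalCycle_iff hg hk hxy]

/-- Fundamental graphs agree if they agree on pairs of a tree edge and a cotree edge. -/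
theorem fundamentalAdj_congr (hg : g ∈ T ↔ g ∈ T') (hk : k ∈ T ↔ k ∈ T')
    (h : g ∈ T → k ∉ T → ((fundamentalAdj S T).Adj g k ↔ (fundamentalAdj S' T').Adj g k))
    (h' : k ∈ T → g ∉ T → ((fundamentalAdj S T).Adj k g ↔ (fundamentalAdj S' T').Adj k g)) :
    (fundamentalAdj S T).Adj g k ↔ (fundamentalAdj S' T').Adj g k := by
  by_cases hgT : g ∈ T <;> by_cases hkT : k ∈ T
  · refine iff_of_false (fun hadj ↦ ?_) fun hadj ↦ ?_ <;>
      have := fundamentalAdj_mem_iff hadj <;> tauto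
  · exact h hgT hkT
  · rw [SimpleGraph.adj_comm, h' hkT hgT, SimpleGraph.adj_comm]
  · refine iff_of_false (fun hadj ↦ ?_) fun hadj ↦ ?_ <;>
      have := fundamentalAdj_mem_iff hadj <;> tauto

namespace IsParallelExtension

variable (h : IsParallelExtension S S' e f)

include h

theorem isLink_iff_of_mem (hg : g ∈ E(S)) : S'.IsLink g a b ↔ S.IsLink g a b := by
  have : g ≠ f := fun hgf ↦ h.notMem (hgf ▸ hg)
  simp [h.isLink_iff, this]

theorem isLink_new_iff : S'.IsLink f a b ↔ S.IsLink e a b := by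
  rw [h.isLink_iff]
  exact ⟨fun hl ↦ hl.elim (fun hl ↦ absurd hl.edge_mem h.notMem) And.right, fun hl ↦ .inr ⟨rfl, hl⟩⟩

theorem edgeSet_eq : E(S') = insert f E(S) := by
  ext g
  by_cases hg : g = f
  · obtain ⟨x, y, hxy⟩ := Graph.exists_isLink_of_mem_edgeSet h.mem
    simp [hg, (h.isLink_new_iff.2 hxy).edge_mem]
  · simp [Graph.edge_mem_iff_exists_isLink, h.isLink_iff, hg]

theorem connectedBy_iff (hA : A ⊆ E(S)) : S'.ConnectedBy A a b ↔ S.ConnectedBy A a b :=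
  ⟨fun hc ↦ hc.lift id fun _ hg _ _ hl ↦ .of_isLink hg ((h.isLink_iff_of_mem (hA hg)).1 hl),
    fun hc ↦ hc.lift id fun _ hg _ _ hl ↦ .of_isLink hg ((h.isLink_iff_of_mem (hA hg)).2 hl)⟩

theorem isSpanningTree_iff (hT : T ⊆ E(S)) : IsSpanningTree S' T ↔ IsSpanningTree S T := by
  constructor
  · intro hT'
    have hne := (Graph.restrict_toSimpleGraph_connected_iff.1 hT'.connected).1
    refine .of_connectedBy hT (h.vertexSet_eq ▸ hne) (fun a ha b hb ↦ ?_) fun g hg ↦ ?_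
    · rw [← h.connectedBy_iff hT]
      rw [← h.vertexSet_eq] at ha hb
      exact hT'.connectedBy ha hb
    · obtain ⟨x, y, hxy⟩ := Graph.exists_isLink_of_mem_edgeSet (hT hg)
      refine ⟨x, y, hxy, ?_⟩
      rw [← h.connectedBy_iff (Set.sdiff_subset.trans hT)]
      exact hT'.not_connectedBy_diff hg ((h.isLink_iff_of_mem (hT hg)).2 hxy)
  · intro hT'
    have hne := (Graph.restrict_toSimpleGraph_connected_iff.1 hT'.connected).1
    refine .of_connectedBy (hT.trans (by simp [h.edgeSet_eq])) (h.vertexSet_eq ▸ hne)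
      (fun a ha b hb ↦ ?_) fun g hg ↦ ?_
    · rw [h.connectedBy_iff hT]
      rw [h.vertexSet_eq] at ha hb
      exact hT'.connectedBy ha hb
    · obtain ⟨x, y, hxy⟩ := Graph.exists_isLink_of_mem_edgeSet (hT hg)
      refine ⟨x, y, (h.isLink_iff_of_mem (hT hg)).2 hxy, ?_⟩
      rw [h.connectedBy_iff (Set.sdiff_subset.trans hT)]
      exact hT'.not_connectedBy_diff hg hxy

variable (hT : IsSpanningTree S T)

include hT

theorem fundamentalAdj_iff (hg : g ∈ E(S)) (hk : k ∈ E(S)) :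
    (fundamentalAdj S T).Adj g k ↔ (fundamentalAdj S' T).Adj g k := by
  have hT' := (h.isSpanningTree_iff hT.subset).2 hT
  have key : ∀ g k, k ∈ E(S) → g ∈ T → k ∉ T →
      ((fundamentalAdj S T).Adj g k ↔ (fundamentalAdj S' T).Adj g k) := by
    intro g k hk hgT hkT
    obtain ⟨x, y, hxy⟩ := Graph.exists_isLink_of_mem_edgeSet hk
    rw [hT.fundamentalAdj_iff hgT hkT hxy,
      hT'.fundamentalAdj_iff hgT hkT ((h.isLink_iff_of_mem hk).2 hxy),
      h.connectedBy_iff (Set.sdiff_subset.trans hT.subset)]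
  exact fundamentalAdj_congr .rfl .rfl (key g k hk) (key k g hg)

/-- The fundamental cycle of `f` is the digon formed by `e` and `f`. -/
theorem fundamentalAdj_pendant (he : e ∈ T) :
    (fundamentalAdj S' T).Adj f g ↔ g = e := by
  have hT' := (h.isSpanningTree_iff hT.subset).2 hT
  have hf : f ∉ T := fun hf ↦ h.notMem (hT.subset hf)
  by_cases hgT : g ∈ T
  · obtain ⟨x, y, hxy⟩ := Graph.exists_isLink_of_mem_edgeSet (hT.subset he)
    rw [SimpleGraph.adj_comm, hT'.fundamentalAdj_iff hgT hf (h.isLink_new_iff.2 hxy)]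
    have hxy' := (h.isLink_iff_of_mem h.mem).2 hxy
    constructor
    · intro hc
      by_contra hge
      exact hc (.of_isLink ⟨he, fun heg ↦ hge heg.symm⟩ hxy')
    · rintro rfl
      exact hT'.not_connectedBy_diff he hxy'
  · refine iff_of_false (fun hadj ↦ ?_) (by rintro rfl; exact hgT he)
    have := fundamentalAdj_mem_iff hadj
    tauto

/-- Two cotree edges with the same ends are separated by the same tree edges. -/
theorem fundamentalAdj_twin (he : e ∉ T) :
    (fundamentalAdj S' T).Adj f g ↔ (fundamentalAdj S' T).Adj e g := by
  have hT' := (h.isSpanningTree_iff hT.subset).2 hT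
  have hf : f ∉ T := fun hf ↦ h.notMem (hT.subset hf)
  by_cases hgT : g ∈ T
  · obtain ⟨x, y, hxy⟩ := Graph.exists_isLink_of_mem_edgeSet h.mem
    rw [SimpleGraph.adj_comm, hT'.fundamentalAdj_iff hgT hf (h.isLink_new_iff.2 hxy),
      SimpleGraph.adj_comm,
      hT'.fundamentalAdj_iff hgT he ((h.isLink_iff_of_mem h.mem).2 hxy)]
  · refine iff_of_false (fun hadj ↦ ?_) (fun hadj ↦ ?_) <;>
      have := fundamentalAdj_mem_iff hadj <;> tauto

end IsParallelExtension

namespace IsSeriesExtension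

variable (h : IsSeriesExtension S S' e f x y w)

include h

theorem edge_ne : e ≠ f := fun hef ↦ h.edge_notMem (hef ▸ h.isLink.edge_mem)

theorem ne_of_mem (ha : a ∈ V(S)) : a ≠ w := fun haw ↦ h.vertex_notMem (haw ▸ ha)

theorem isLink_iff_of_mem (hg : g ∈ E(S)) (hge : g ≠ e) :
    S'.IsLink g a b ↔ S.IsLink g a b := by
  have : g ≠ f := fun hgf ↦ h.edge_notMem (hgf ▸ hg)
  simp [h.isLink_iff, this, hge]

theorem isLink_old_iff : S'.IsLink e a b ↔ s(a, b) = s(x, w) := by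
  simp [h.isLink_iff, h.edge_ne]

theorem isLink_new_iff : S'.IsLink f a b ↔ s(a, b) = s(w, y) := by
  simp [h.isLink_iff, h.edge_ne.symm, Graph.not_isLink_of_notMem_edgeSet h.edge_notMem]

theorem isLink_left : S'.IsLink e x w := h.isLink_old_iff.2 rfl

theorem isLink_right : S'.IsLink f w y := h.isLink_new_iff.2 rfl

theorem edgeSet_eq : E(S') = insert f E(S) := by
  ext g
  by_cases hgf : g = f
  · simp [hgf, h.isLink_right.edge_mem]
  by_cases hge : g = e
  · simp [hge, h.isLink_left.edge_mem, h.isLink.edge_mem]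
  simp [Graph.edge_mem_iff_exists_isLink, h.isLink_iff, hgf, hge]

theorem notMem_of_subset (hA : A ⊆ E(S)) : f ∉ A := fun hf ↦ h.edge_notMem (hA hf)

theorem insert_diff (hA : A ⊆ E(S)) (hg : g ∈ A) :
    insert f A \ {g} = insert f (A \ {g}) :=
  Set.insert_sdiff_of_notMem _ fun hfg ↦ h.notMem_of_subset hA (hfg ▸ hg)

theorem connectedBy_iff_of_notMem (hA : A ⊆ E(S)) (he : e ∉ A) :
    S'.ConnectedBy A a b ↔ S.ConnectedBy A a b := by
  have hne : ∀ g ∈ A, g ≠ e := fun g hg hge ↦ he (hge ▸ hg)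
  exact ⟨fun hc ↦ hc.lift id fun _ hg _ _ hl ↦
      .of_isLink hg ((h.isLink_iff_of_mem (hA hg) (hne _ hg)).1 hl),
    fun hc ↦ hc.lift id fun _ hg _ _ hl ↦
      .of_isLink hg ((h.isLink_iff_of_mem (hA hg) (hne _ hg)).2 hl)⟩

open Classical in
/-- Contracting the new edge `f` maps edges to edges. -/
theorem isLink_contract (hg : g ∈ E(S)) (hl : S'.IsLink g a b) :
    S.IsLink g (if a = w then y else a) (if b = w then y else b) := by
  by_cases hge : g = e
  · subst hge
    have hx := h.ne_of_mem h.isLink.left_mem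
    rw [h.isLink_old_iff, Sym2.eq_iff] at hl
    rcases hl with ⟨rfl, rfl⟩ | ⟨rfl, rfl⟩
    · simpa [hx] using h.isLink
    · simpa [hx] using h.isLink.symm
  · rw [h.isLink_iff_of_mem hg hge] at hl
    simpa [h.ne_of_mem hl.left_mem, h.ne_of_mem hl.right_mem] using hl

open Classical in
-- With `f` available, the vertices `w` and `y` are interchangeable, and contracting `f` turns `S'`
-- back into `S`.
theorem connectedBy_insert_iff (hA : A ⊆ E(S)) : S'.ConnectedBy (insert f A) a b ↔
    S.ConnectedBy A (if a = w then y else a) (if b = w then y else b) := by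
  constructor
  · intro hc
    refine hc.lift (fun a ↦ if a = w then y else a) ?_
    rintro g (rfl | hg) p q hl
    · have hy := h.ne_of_mem h.isLink.right_mem
      rw [h.isLink_new_iff, Sym2.eq_iff] at hl
      rcases hl with ⟨rfl, rfl⟩ | ⟨rfl, rfl⟩ <;> simp <;> rfl
    · exact .of_isLink hg (h.isLink_contract (hA hg) hl)
  · intro hc
    have hπ : ∀ a, S'.ConnectedBy (insert f A) a (if a = w then y else a) := by
      intro a
      split_ifs with ha
      · subst ha
        exact .of_isLink (.inl rfl) h.isLink_right
      · rfl
    refine (hπ a).trans (.trans ?_ (hπ b).symm)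
    refine hc.lift id fun g hg p q hl ↦ ?_
    by_cases hge : g = e
    · subst hge
      have hxy : S'.ConnectedBy (insert f A) x y :=
        .trans (.of_isLink (.inr hg) h.isLink_left) (.of_isLink (.inl rfl) h.isLink_right)
      rcases h.isLink.eq_and_eq_or_eq_and_eq hl with ⟨rfl, rfl⟩ | ⟨rfl, rfl⟩
      · exact hxy
      · exact hxy.symm
    · exact .of_isLink (.inr hg) ((h.isLink_iff_of_mem (hA hg) hge).2 hl)

theorem connectedBy_insert_iff_of_mem (hA : A ⊆ E(S)) (ha : a ∈ V(S)) (hb : b ∈ V(S)) :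
    S'.ConnectedBy (insert f A) a b ↔ S.ConnectedBy A a b := by
  classical
  rw [h.connectedBy_insert_iff hA, if_neg (h.ne_of_mem ha), if_neg (h.ne_of_mem hb)]

open Classical in
/-- Without the new edge `f`, the new vertex hangs at `x` by the edge `e`. -/
theorem connectedBy_of_connectedBy (hA : A ⊆ E(S)) (hc : S'.ConnectedBy A a b) :
    S.ConnectedBy (A \ {e}) (if a = w then x else a) (if b = w then x else b) := by
  refine hc.lift (fun a ↦ if a = w then x else a) fun g hg p q hl ↦ ?_
  by_cases hge : g = e
  · subst hge
    rw [h.isLink_old_iff, Sym2.eq_iff] at hl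
    rcases hl with ⟨rfl, rfl⟩ | ⟨rfl, rfl⟩ <;> simp <;> rfl
  · rw [h.isLink_iff_of_mem (hA hg) hge] at hl
    simpa [h.ne_of_mem hl.left_mem, h.ne_of_mem hl.right_mem] using .of_isLink ⟨hg, hge⟩ hl

/-- Without `f`, the edge `e` leads only to a dead end at `w`. -/
theorem connectedBy_iff_diff (hA : A ⊆ E(S)) (ha : a ∈ V(S)) (hb : b ∈ V(S)) :
    S'.ConnectedBy A a b ↔ S.ConnectedBy (A \ {e}) a b := by
  classical
  constructor
  · intro hc
    simpa [h.ne_of_mem ha, h.ne_of_mem hb] using h.connectedBy_of_connectedBy hA hc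
  · intro hc
    exact ((h.connectedBy_iff_of_notMem (Set.sdiff_subset.trans hA) (by simp)).2 hc).mono
      Set.sdiff_subset

theorem not_connectedBy_new (hA : A ⊆ E(S)) (he : e ∉ A) (ha : a ∈ V(S)) :
    ¬ S'.ConnectedBy A w a := by
  intro hc
  rw [h.connectedBy_iff_of_notMem hA he] at hc
  exact h.ne_of_mem ha (hc.eq_of_forall_not_isLink
    fun g _ c hl ↦ h.vertex_notMem hl.left_mem).symm

/-- Contracting `f` matches the spanning trees of `S'` through `f` with those of `S`. -/
theorem isSpanningTree_iff (hTS : T ⊆ E(S)) :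
    IsSpanningTree S' (insert f T) ↔ IsSpanningTree S T := by
  classical
  constructor
  · intro hT'
    refine .of_connectedBy hTS ⟨x, h.isLink.left_mem⟩ (fun a ha b hb ↦ ?_) fun g hg ↦ ?_
    · rw [← h.connectedBy_insert_iff_of_mem hTS ha hb]
      exact hT'.connectedBy (by simp [h.vertexSet_eq, ha]) (by simp [h.vertexSet_eq, hb])
    · obtain ⟨p, q, hpq⟩ := Graph.exists_isLink_of_mem_edgeSet (hT'.subset (.inr hg))
      refine ⟨_, _, h.isLink_contract (hTS hg) hpq, ?_⟩
      rw [← h.connectedBy_insert_iff (Set.sdiff_subset.trans hTS), ← h.insert_diff hTS hg]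
      exact hT'.not_connectedBy_diff (.inr hg) hpq
  · intro hT
    have hsub : insert f T ⊆ E(S') := by
      rw [h.edgeSet_eq]
      exact Set.insert_subset_insert hTS
    have hmem : ∀ a ∈ V(S'), (if a = w then y else a) ∈ V(S) := by
      intro a ha
      rw [h.vertexSet_eq] at ha
      split_ifs with haw
      · exact h.isLink.right_mem
      · exact ha.resolve_left haw
    refine .of_connectedBy hsub ⟨x, h.isLink_left.left_mem⟩ (fun a ha b hb ↦ ?_) ?_
    · rw [h.connectedBy_insert_iff hTS]
      exact hT.connectedBy (hmem a ha) (hmem b hb)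
    · rintro g (rfl | hg)
      · refine ⟨w, y, h.isLink_right, ?_⟩
        rw [Set.insert_sdiff_self_of_notMem (h.notMem_of_subset hTS)]
        -- Removing `f` leaves `w` hanging at `x`, on the other side of the bridge `e`, if `e` is in
        -- the tree, and isolated otherwise.
        by_cases he : e ∈ T
        · intro hc
          have hc' := h.connectedBy_of_connectedBy hTS hc
          rw [if_pos rfl, if_neg (h.ne_of_mem h.isLink.right_mem)] at hc'
          exact hT.not_connectedBy_diff he h.isLink hc'
        · exact h.not_connectedBy_new hTS he h.isLink.right_mem
      · obtain ⟨p, q, hpq⟩ := Graph.exists_isLink_of_mem_edgeSet (hsub (.inr hg))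
        refine ⟨p, q, hpq, ?_⟩
        rw [h.insert_diff hTS hg, h.connectedBy_insert_iff (Set.sdiff_subset.trans hTS)]
        exact hT.not_connectedBy_diff hg (h.isLink_contract (hTS hg) hpq)

variable (hT : IsSpanningTree S T)

include hT

theorem fundamentalAdj_iff (hg : g ∈ E(S)) (hk : k ∈ E(S)) :
    (fundamentalAdj S T).Adj g k ↔ (fundamentalAdj S' (insert f T)).Adj g k := by
  classical
  have hT' := (h.isSpanningTree_iff hT.subset).2 hT
  have hmem : ∀ g ∈ E(S), (g ∈ T ↔ g ∈ insert f T) := by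
    intro g hg
    have : g ≠ f := fun hgf ↦ h.edge_notMem (hgf ▸ hg)
    simp [this]
  have key : ∀ g k, k ∈ E(S) → g ∈ T → k ∉ T →
      ((fundamentalAdj S T).Adj g k ↔ (fundamentalAdj S' (insert f T)).Adj g k) := by
    intro g k hk hgT hkT
    obtain ⟨p, q, hpq⟩ := Graph.exists_isLink_of_mem_edgeSet
      (h.edgeSet_eq ▸ Set.mem_insert_of_mem f hk : k ∈ E(S'))
    rw [hT.fundamentalAdj_iff hgT hkT (h.isLink_contract hk hpq),
      hT'.fundamentalAdj_iff (.inr hgT) (by rwa [← hmem k hk]) hpq, h.insert_diff hT.subset hgT,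
      h.connectedBy_insert_iff (Set.sdiff_subset.trans hT.subset)]
  exact fundamentalAdj_congr (hmem g hg) (hmem k hk) (key g k hk) (key k g hg)

theorem fundamentalAdj_new_iff (hg : g ∈ E(S)) (hgT : g ∉ T) (hl : S'.IsLink g p q) :
    (fundamentalAdj S' (insert f T)).Adj f g ↔ ¬ S'.ConnectedBy T p q := by
  have hT' := (h.isSpanningTree_iff hT.subset).2 hT
  have hgf : g ≠ f := fun hgf ↦ h.edge_notMem (hgf ▸ hg)
  rw [hT'.fundamentalAdj_iff (.inl rfl) (by simp [hgf, hgT]) hl,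
    Set.insert_sdiff_self_of_notMem (h.notMem_of_subset hT.subset)]

/-- Here `f` is the only tree edge at `w`, so its removal cuts off `w` alone, and `e` is the only
cotree edge there. -/
theorem fundamentalAdj_pendant (he : e ∉ T) (hg : g ∈ E(S)) :
    (fundamentalAdj S' (insert f T)).Adj f g ↔ g = e := by
  by_cases hgT : g ∈ T
  · refine iff_of_false (fun hadj ↦ ?_) (by rintro rfl; exact he hgT)
    have := fundamentalAdj_mem_iff hadj
    simp [hgT] at this
  by_cases hge : g = e
  · subst hge
    simp only [h.fundamentalAdj_new_iff hT hg hgT h.isLink_left.symm, iff_true]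
    exact h.not_connectedBy_new hT.subset he h.isLink.left_mem
  · obtain ⟨p, q, hpq⟩ := Graph.exists_isLink_of_mem_edgeSet hg
    rw [h.fundamentalAdj_new_iff hT hg hgT ((h.isLink_iff_of_mem hg hge).2 hpq)]
    simp only [hge, iff_false, not_not]
    rw [h.connectedBy_iff_of_notMem hT.subset he]
    exact hT.connectedBy hpq.left_mem hpq.right_mem

/-- With both halves of the subdivided edge in the tree, removing either one separates the old
vertices in the same way. -/
theorem fundamentalAdj_twin (he : e ∈ T) (hg : g ∈ E(S)) :
    (fundamentalAdj S' (insert f T)).Adj f g ↔ (fundamentalAdj S' (insert f T)).Adj e g := by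
  by_cases hgT : g ∈ T
  · refine iff_of_false (fun hadj ↦ ?_) (fun hadj ↦ ?_) <;>
      have := fundamentalAdj_mem_iff hadj <;> simp [hgT, he] at this
  have hge : g ≠ e := by rintro rfl; exact hgT he
  obtain ⟨p, q, hpq⟩ := Graph.exists_isLink_of_mem_edgeSet hg
  rw [h.fundamentalAdj_new_iff hT hg hgT ((h.isLink_iff_of_mem hg hge).2 hpq),
    h.connectedBy_iff_diff hT.subset hpq.left_mem hpq.right_mem,
    ← h.fundamentalAdj_iff hT h.isLink.edge_mem hg, hT.fundamentalAdj_iff he hgT hpq]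

end IsSeriesExtension

end

/-! ### Relabelling edges, and the common neighbor property of fundamental graphs -/

section

namespace Graph

variable {α β : Type*}

/-- The multigraph with edges renamed along a permutation of the edge labels. -/
def relabel (S : Graph α β) (σ : Equiv.Perm β) : Graph α β where
  vertexSet := V(S)
  IsLink g := S.IsLink (σ.symm g)
  isLink_symm := fun _ _ ↦ ⟨fun _ _ h ↦ h.symm⟩
  eq_or_eq_of_isLink_of_isLink := fun _ _ _ _ _ h h' ↦ h.left_eq_or_eq h'
  left_mem_of_isLink := fun _ _ _ h ↦ h.left_mem

variable {S : Graph α β} {σ : Equiv.Perm β} {A C T : Set β} {a b : α} {g k : β}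

@[simp] theorem relabel_isLink : (S.relabel σ).IsLink g a b ↔ S.IsLink (σ.symm g) a b := .rfl

@[simp] theorem mem_edgeSet_relabel : g ∈ E(S.relabel σ) ↔ σ.symm g ∈ E(S) := by
  simp [edge_mem_iff_exists_isLink]

theorem relabel_symm_relabel : (S.relabel σ).relabel σ.symm = S :=
  Graph.ext rfl fun g a b ↦ by simp

theorem ConnectedBy.relabel (σ : Equiv.Perm β) (h : S.ConnectedBy A a b) :
    (S.relabel σ).ConnectedBy (σ '' A) a b :=
  h.lift id fun g hg _ _ hl ↦ .of_isLink ⟨g, hg, rfl⟩ (by simpa using hl)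

theorem connectedBy_relabel_iff :
    (S.relabel σ).ConnectedBy (σ '' A) a b ↔ S.ConnectedBy A a b := by
  refine ⟨fun h ↦ ?_, .relabel σ⟩
  have := h.relabel σ.symm
  rwa [relabel_symm_relabel, ← Set.image_comp, Equiv.symm_comp_self, Set.image_id] at this

end Graph

open Graph SimpleGraph

variable {α β : Type*} {S S' : Graph α β} {σ : Equiv.Perm β} {A C T : Set β} {a b x y w : α}
  {e f g k : β}

theorem IsSpanningTree.relabel (hT : IsSpanningTree S T) (σ : Equiv.Perm β) :
    IsSpanningTree (S.relabel σ) (σ '' T) := by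
  refine .of_connectedBy ?_ (restrict_toSimpleGraph_connected_iff.1 hT.connected).1
    (fun a ha b hb ↦ (hT.connectedBy ha hb).relabel σ) ?_
  · rintro _ ⟨g, hg, rfl⟩
    simpa using hT.subset hg
  · rintro _ ⟨g, hg, rfl⟩
    obtain ⟨x, y, hxy⟩ := exists_isLink_of_mem_edgeSet (hT.subset hg)
    refine ⟨x, y, by simpa using hxy, ?_⟩
    rw [← Set.image_singleton, ← Set.image_sdiff σ.injective, connectedBy_relabel_iff]
    exact hT.not_connectedBy_diff hg hxy

theorem IsCycleEdgeSet.relabel (hC : IsCycleEdgeSet S C) (σ : Equiv.Perm β) :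
    IsCycleEdgeSet (S.relabel σ) (σ '' C) := by
  obtain ⟨n, v, e, hv, he, hl, rfl⟩ := hC
  exact ⟨n, v, σ ∘ e, hv, σ.injective.comp he, by simpa using hl, Set.range_comp σ e⟩

theorem MemFundamentalCycle.relabel (h : MemFundamentalCycle S T f e) (σ : Equiv.Perm β) :
    MemFundamentalCycle (S.relabel σ) (σ '' T) (σ f) (σ e) := by
  obtain ⟨C, hC, hCT, he⟩ := h
  exact ⟨σ '' C, hC.relabel σ, (Set.image_mono hCT).trans_eq (Set.image_insert_eq ..),
    e, he, rfl⟩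

theorem memFundamentalCycle_relabel_iff :
    MemFundamentalCycle (S.relabel σ) (σ '' T) (σ f) (σ e) ↔ MemFundamentalCycle S T f e := by
  refine ⟨fun h ↦ ?_, fun h ↦ h.relabel σ⟩
  have := h.relabel σ.symm
  rwa [relabel_symm_relabel, ← Set.image_comp, Equiv.symm_comp_self, Set.image_id,
    Equiv.symm_apply_apply, Equiv.symm_apply_apply] at this

theorem fundamentalAdj_relabel_iff :
    (fundamentalAdj (S.relabel σ) (σ '' T)).Adj (σ g) (σ k) ↔ (fundamentalAdj S T).Adj g k := by
  simp [fundamentalAdj, memFundamentalCycle_relabel_iff]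

theorem IsParallelExtension.relabel_swap [DecidableEq β] (h : IsParallelExtension S S' e f) :
    IsParallelExtension S (S'.relabel (Equiv.swap e f)) e f where
  mem := h.mem
  notMem := h.notMem
  vertexSet_eq := h.vertexSet_eq
  isLink_iff g a b := by
    have hef : e ≠ f := fun hef ↦ h.notMem (hef ▸ h.mem)
    by_cases hge : g = e
    · simp [hge, hef, h.isLink_new_iff]
    by_cases hgf : g = f
    · simp [hgf, h.isLink_iff_of_mem h.mem, not_isLink_of_notMem_edgeSet h.notMem]
    · simp [Equiv.swap_apply_of_ne_of_ne hge hgf, h.isLink_iff]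

/-- Exchanging the two halves of the subdivided edge amounts to reading it from `y` to `x`. -/
theorem IsSeriesExtension.relabel_swap [DecidableEq β] (h : IsSeriesExtension S S' e f x y w) :
    IsSeriesExtension S (S'.relabel (Equiv.swap e f)) e f y x w where
  isLink := h.isLink.symm
  edge_notMem := h.edge_notMem
  vertex_notMem := h.vertex_notMem
  vertexSet_eq := h.vertexSet_eq
  isLink_iff g a b := by
    have hef : e ≠ f := h.edge_ne
    by_cases hge : g = e
    · simp only [relabel_isLink, hge, Equiv.symm_swap, Equiv.swap_apply_left, h.isLink_new_iff,
        Sym2.eq_swap (a := w)]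
      simp [hef]
    by_cases hgf : g = f
    · simp only [relabel_isLink, hgf, Equiv.symm_swap, Equiv.swap_apply_right, h.isLink_old_iff,
        Sym2.eq_swap (a := w)]
      simp [hef.symm, not_isLink_of_notMem_edgeSet h.edge_notMem]
    · simp [Equiv.swap_apply_of_ne_of_ne hge hgf, h.isLink_iff, hge, hgf]

/-- Adding an edge in parallel to `e` adds a pendant vertex at `e`, or a false twin of `e`, to the
fundamental graph. -/
theorem IsParallelExtension.hasInducedCommonNeighbors (h : IsParallelExtension S S' e f)
    (hT : IsSpanningTree S T) (hS : (fundamentalAdj S T).HasInducedCommonNeighbors E(S)) :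
    (fundamentalAdj S' T).HasInducedCommonNeighbors E(S') := by
  have hS := hS.congr fun a ha b hb ↦ h.fundamentalAdj_iff hT ha hb
  rw [h.edgeSet_eq]
  by_cases he : e ∈ T
  · exact hS.insert_pendant h.notMem fun g _ ↦ h.fundamentalAdj_pendant hT he
  · exact hS.insert_twin h.mem h.notMem fun g _ ↦ h.fundamentalAdj_twin hT he

/-- Subdividing `e` adds a pendant vertex at `e`, or a false twin of `e`, to the fundamental
graph. -/
theorem IsSeriesExtension.hasInducedCommonNeighbors (h : IsSeriesExtension S S' e f x y w)
    (hT : IsSpanningTree S T) (hS : (fundamentalAdj S T).HasInducedCommonNeighbors E(S)) :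
    (fundamentalAdj S' (insert f T)).HasInducedCommonNeighbors E(S') := by
  have hS := hS.congr fun a ha b hb ↦ h.fundamentalAdj_iff hT ha hb
  rw [h.edgeSet_eq]
  by_cases he : e ∈ T
  · exact hS.insert_twin h.isLink.edge_mem h.edge_notMem fun g hg ↦ h.fundamentalAdj_twin hT he hg
  · exact hS.insert_pendant h.edge_notMem fun g hg ↦ h.fundamentalAdj_pendant hT he hg

theorem hasInducedCommonNeighbors_of_relabel (σ : Equiv.Perm β)
    (h : (fundamentalAdj (S.relabel σ) (σ '' T)).HasInducedCommonNeighbors E(S.relabel σ)) :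
    (fundamentalAdj S T).HasInducedCommonNeighbors E(S) :=
  h.of_embedding σ.injective (fun _ _ ↦ fundamentalAdj_relabel_iff) fun _ hg ↦ by simpa using hg

/-- The fundamental graphs of series-parallel multigraphs have the common neighbor property. -/
theorem IsSeriesParallel.hasInducedCommonNeighbors (hS : IsSeriesParallel S) :
    ∀ T, IsSpanningTree S T → (fundamentalAdj S T).HasInducedCommonNeighbors E(S) := by
  classical
  induction hS with
  | digon hxy hef =>
    -- A digon has two edges, too few for distinct `a`, `b` and a common neighbor `c`.
    intro T _ s hst _ a ha b hb hab _ c hc hac hcb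
    have h1 := (fundamentalAdj _ T).ne_of_adj hac
    have h2 := (fundamentalAdj _ T).ne_of_adj hcb
    have ha := hst ha
    have hb := hst hb
    simp only [edgeSet_banana, Set.mem_insert_iff, Set.mem_singleton_iff] at ha hb hc
    grind
  | @parallel S S' e f _ h ih =>
    have main : ∀ S', IsParallelExtension S S' e f → ∀ T, f ∉ T → IsSpanningTree S' T →
        (fundamentalAdj S' T).HasInducedCommonNeighbors E(S') := by
      intro S' h T hf hT
      have hTS : T ⊆ E(S) := fun g hg ↦
        ((h.edgeSet_eq ▸ hT.subset hg : g ∈ insert f E(S))).resolve_left fun hgf ↦ hf (hgf ▸ hg)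
      have hT' := (h.isSpanningTree_iff hTS).1 hT
      exact h.hasInducedCommonNeighbors hT' (ih T hT')
    intro T hT
    by_cases hf : f ∈ T
    -- The tree cannot contain both parallel edges, so exchanging the labels moves `f` out of it.
    · refine hasInducedCommonNeighbors_of_relabel (Equiv.swap e f)
        (main _ h.relabel_swap _ ?_ (hT.relabel _))
      rintro ⟨g, hg, hgf⟩
      obtain rfl : g = e := by
        rw [Equiv.swap_apply_eq_iff] at hgf
        simpa using hgf
      obtain ⟨x, y, hxy⟩ := exists_isLink_of_mem_edgeSet h.mem
      exact hT.not_connectedBy_diff hf (h.isLink_new_iff.2 hxy)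
        (.of_isLink ⟨hg, fun hgf ↦ h.notMem (hgf ▸ h.mem)⟩ ((h.isLink_iff_of_mem h.mem).2 hxy))
    · exact main S' h T hf hT
  | @series S S' e f x y w _ h ih =>
    have main : ∀ S' x y, IsSeriesExtension S S' e f x y w → ∀ T, f ∈ T → IsSpanningTree S' T →
        (fundamentalAdj S' T).HasInducedCommonNeighbors E(S') := by
      intro S' x y h T hf hT
      have hTS : T \ {f} ⊆ E(S) := fun g hg ↦
        ((h.edgeSet_eq ▸ hT.subset hg.1 : g ∈ insert f E(S))).resolve_left hg.2
      have hTf : insert f (T \ {f}) = T := Set.insert_sdiff_self_of_mem hf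
      rw [← hTf] at hT ⊢
      have hT' := (h.isSpanningTree_iff hTS).1 hT
      exact h.hasInducedCommonNeighbors hT' (ih _ hT')
    intro T hT
    by_cases hf : f ∈ T
    · exact main S' x y h T hf hT
    -- The tree must reach `w` by `e` if not by `f`, so exchanging the labels moves `f` into it.
    · refine hasInducedCommonNeighbors_of_relabel (Equiv.swap e f)
        (main _ y x h.relabel_swap _ ?_ (hT.relabel _))
      refine ⟨e, ?_, by simp⟩
      by_contra he
      have hTS : T ⊆ E(S) := fun g hg ↦
        ((h.edgeSet_eq ▸ hT.subset hg : g ∈ insert f E(S))).resolve_left fun hgf ↦ hf (hgf ▸ hg)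
      refine h.not_connectedBy_new hTS he h.isLink.left_mem (hT.connectedBy ?_ ?_) <;>
        simp [h.vertexSet_eq, h.isLink.left_mem]

/-! ### Two-connectedness of series-parallel multigraphs -/

/-- A nontrivial loopless multigraph that has an edge and stays connected on deleting any single
edge or vertex. -/
structure IsSturdy (S : Graph α β) : Prop where
  nontrivial : V(S).Nontrivial
  edgeSet_nonempty : E(S).Nonempty
  ne_of_isLink : ∀ g a b, S.IsLink g a b → a ≠ b
  connectedBy_edge : ∀ g, ∀ a ∈ V(S), ∀ b ∈ V(S), S.ConnectedBy (E(S) \ {g}) a b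
  connectedBy_vertex : ∀ v ∈ V(S), ∀ a ∈ V(S), a ≠ v → ∀ b ∈ V(S), b ≠ v →
    S.ConnectedBy {g | g ∈ E(S) ∧ ¬ S.Inc g v} a b

theorem isSturdy_banana (hxy : x ≠ y) (hef : e ≠ f) : IsSturdy (banana x y {e, f}) where
  nontrivial := by simpa using Set.nontrivial_pair hxy
  edgeSet_nonempty := ⟨e, by simp⟩
  ne_of_isLink g a b h := by
    rw [banana_isLink] at h
    rcases h.2 with ⟨rfl, rfl⟩ | ⟨rfl, rfl⟩
    · exact hxy
    · exact hxy.symm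
  connectedBy_edge g a ha b hb := by
    obtain ⟨k, hk, hkg⟩ : ∃ k, (k = e ∨ k = f) ∧ k ≠ g := by
      by_cases he : e = g
      · exact ⟨f, .inr rfl, fun h ↦ hef (he.trans h.symm)⟩
      · exact ⟨e, .inl rfl, he⟩
    have h : (banana x y {e, f}).ConnectedBy (E(banana x y {e, f}) \ {g}) x y :=
      .of_isLink (g := k) ⟨by simpa using hk, hkg⟩ (by simpa using hk)
    simp only [vertexSet_banana, Set.mem_insert_iff, Set.mem_singleton_iff] at ha hb
    rcases ha with rfl | rfl <;> rcases hb with rfl | rfl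
    · rfl
    · exact h
    · exact h.symm
    · rfl
  connectedBy_vertex v hv a ha hav b hb hbv := by
    simp only [vertexSet_banana, Set.mem_insert_iff, Set.mem_singleton_iff] at ha hb hv
    obtain rfl : a = b := by grind
    rfl

theorem IsSturdy.isTwoConnected (h : IsSturdy S) : IsTwoConnected S where
  nontrivial := h.nontrivial
  loopless := by
    rw [loopless_iff_forall_ne_of_adj]
    rintro a b ⟨g, hg⟩
    exact h.ne_of_isLink g a b hg
  connected := by
    rw [toSimpleGraph_connected_iff]
    obtain ⟨x, hx, y, hy, hxy⟩ := h.nontrivial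
    refine ⟨⟨x, hx⟩, fun a ha b hb ↦ ?_⟩
    obtain ⟨g, -⟩ := h.edgeSet_nonempty
    exact (h.connectedBy_edge g a ha b hb).mono (Set.subset_univ _)
  no_cut_vertex v hv := by
    rw [deleteVerts_toSimpleGraph_connected_iff]
    refine ⟨?_, fun a ha hav b hb hbv ↦ (h.connectedBy_vertex v hv a ha hav b hb hbv).mono
      fun g hg ↦ hg.2⟩
    obtain ⟨y, hy, hyv⟩ := h.nontrivial.exists_ne v
    exact ⟨y, hy, hyv⟩

theorem IsSturdy.parallel (hS : IsSturdy S) (h : IsParallelExtension S S' e f) :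
    IsSturdy S' where
  nontrivial := h.vertexSet_eq ▸ hS.nontrivial
  edgeSet_nonempty := ⟨f, by simp [h.edgeSet_eq]⟩
  ne_of_isLink g a b hl := by
    rw [h.isLink_iff] at hl
    exact hl.elim (hS.ne_of_isLink _ _ _) fun hl ↦ hS.ne_of_isLink _ _ _ hl.2
  connectedBy_edge g a ha b hb := by
    rw [h.vertexSet_eq] at ha hb
    refine ((h.connectedBy_iff Set.sdiff_subset).2 (hS.connectedBy_edge g a ha b hb)).mono ?_
    rw [h.edgeSet_eq]
    exact Set.sdiff_subset_sdiff_left (Set.subset_insert _ _)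
  connectedBy_vertex v hv a ha hav b hb hbv := by
    rw [h.vertexSet_eq] at hv ha hb
    refine ((h.connectedBy_iff fun g hg ↦ hg.1).2
      (hS.connectedBy_vertex v hv a ha hav b hb hbv)).mono ?_
    rintro g ⟨hg, hgv⟩
    refine ⟨by simp [h.edgeSet_eq, hg], fun ⟨c, hc⟩ ↦ hgv ⟨c, (h.isLink_iff_of_mem hg).1 hc⟩⟩

/-- Deleting the new vertex amounts to deleting `e` from `S`, which is why the invariant includes
edge deletion: two vertices joined by a single edge are 2-connected, but subdividing that edge
creates a cut vertex. -/
theorem IsSturdy.series (hS : IsSturdy S) (h : IsSeriesExtension S S' e f x y w) :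
    IsSturdy S' where
  nontrivial := hS.nontrivial.mono (by simp [h.vertexSet_eq])
  edgeSet_nonempty := ⟨f, by simp [h.edgeSet_eq]⟩
  ne_of_isLink g a b hl := by
    have hx := h.ne_of_mem h.isLink.left_mem
    have hy := h.ne_of_mem h.isLink.right_mem
    rw [h.isLink_iff, Sym2.eq_iff, Sym2.eq_iff] at hl
    rcases hl with hl | ⟨-, ⟨rfl, rfl⟩ | ⟨rfl, rfl⟩⟩ | ⟨-, ⟨rfl, rfl⟩ | ⟨rfl, rfl⟩⟩
    · exact hS.ne_of_isLink _ _ _ hl.2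
    · exact hx
    · exact hx.symm
    · exact hy.symm
    · exact hy
  connectedBy_edge g := by
    -- it suffices to treat old vertices and one edge at the new vertex
    have hold : ∀ a ∈ V(S), S'.ConnectedBy (E(S') \ {g}) a y := by
      intro a ha
      by_cases hg : g = e ∨ g = f
      · refine ((h.connectedBy_iff_of_notMem Set.sdiff_subset (by simp)).2
          (hS.connectedBy_edge e a ha y h.isLink.right_mem)).mono ?_
        rintro k ⟨hk, hke⟩
        refine ⟨by simp [h.edgeSet_eq, hk], ?_⟩
        rintro rfl
        rcases hg with rfl | rfl
        · exact hke rfl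
        · exact h.edge_notMem hk
      · push Not at hg
        refine ((h.connectedBy_insert_iff_of_mem Set.sdiff_subset ha h.isLink.right_mem).2
          (hS.connectedBy_edge g a ha y h.isLink.right_mem)).mono ?_
        rintro k (rfl | hk)
        · exact ⟨by simp [h.edgeSet_eq], fun hkg ↦ hg.2 hkg.symm⟩
        · exact ⟨by simp [h.edgeSet_eq, hk.1], hk.2⟩
    have hall : ∀ a ∈ V(S'), S'.ConnectedBy (E(S') \ {g}) a y := by
      intro a ha
      rw [h.vertexSet_eq] at ha
      rcases ha with rfl | ha
      · by_cases hgf : g = f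
        · refine .trans (.of_isLink (g := e) ⟨h.isLink_left.edge_mem, ?_⟩ h.isLink_left.symm)
            (hold x h.isLink.left_mem)
          rintro rfl
          exact h.edge_ne hgf
        · exact .of_isLink ⟨h.isLink_right.edge_mem, fun hfg ↦ hgf hfg.symm⟩ h.isLink_right
      · exact hold a ha
    exact fun a ha b hb ↦ (hall a ha).trans (hall b hb).symm
  connectedBy_vertex v hv := by
    have hx := h.ne_of_mem h.isLink.left_mem
    have hy := h.ne_of_mem h.isLink.right_mem
    have hxy : x ≠ y := hS.ne_of_isLink _ _ _ h.isLink
    have hinc : ∀ k ∈ E(S), v ≠ w → ¬ S.Inc k v → ¬ S'.Inc k v := by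
      rintro k hk hvw hkv ⟨c, hc⟩
      have := h.isLink_contract hk hc
      rw [if_neg hvw] at this
      exact hkv ⟨_, this⟩
    rw [h.vertexSet_eq] at hv
    rcases eq_or_ne v w with rfl | hvw
    · intro a ha hav b hb hbv
      rw [h.vertexSet_eq] at ha hb
      refine ((h.connectedBy_iff_of_notMem Set.sdiff_subset (by simp)).2
        (hS.connectedBy_edge e a (ha.resolve_left hav) b (hb.resolve_left hbv))).mono ?_
      rintro k ⟨hk, hke⟩
      refine ⟨by simp [h.edgeSet_eq, hk], ?_⟩
      rintro ⟨c, hc⟩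
      rw [h.isLink_iff_of_mem hk hke] at hc
      exact h.vertex_notMem hc.left_mem
    have hvS : v ∈ V(S) := hv.resolve_left hvw
    -- the base vertex is an end of `e` other than `v`
    obtain ⟨z, k, hzV, hzv, hlz⟩ : ∃ z k, z ∈ V(S) ∧ z ≠ v ∧ S'.IsLink k w z := by
      by_cases hvx : v = x
      · exact ⟨y, f, h.isLink.right_mem, fun h ↦ hxy (hvx.symm.trans h.symm), h.isLink_right⟩
      · exact ⟨x, e, h.isLink.left_mem, fun h ↦ hvx h.symm, h.isLink_left.symm⟩
    have hall : ∀ a ∈ V(S'), a ≠ v → S'.ConnectedBy {g | g ∈ E(S') ∧ ¬ S'.Inc g v} a z := by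
      intro a ha hav
      rw [h.vertexSet_eq] at ha
      rcases ha with rfl | ha
      · refine .of_isLink ⟨hlz.edge_mem, fun hk ↦ ?_⟩ hlz
        rcases hk.eq_or_eq_of_isLink hlz with rfl | rfl
        · exact hvw rfl
        · exact hzv rfl
      have hS' := hS.connectedBy_vertex v hvS a ha hav z hzV hzv
      -- For `v = y` the edge `f` disappears, but so does `e` in `S`, and the old walk survives
      -- unchanged. Otherwise `f` remains and can be contracted.
      by_cases hvy : v = y
      · refine ((h.connectedBy_iff_of_notMem (fun g hg ↦ hg.1) ?_).2 hS').mono ?_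
        · rintro ⟨-, he⟩
          exact he (hvy ▸ h.isLink.inc_right)
        · rintro k ⟨hk, hkv⟩
          exact ⟨by simp [h.edgeSet_eq, hk], hinc k hk hvw hkv⟩
      · refine ((h.connectedBy_insert_iff_of_mem (fun g hg ↦ hg.1) ha hzV).2 hS').mono ?_
        rintro k (rfl | ⟨hk, hkv⟩)
        · refine ⟨h.isLink_right.edge_mem, fun hk ↦ ?_⟩
          exact (hk.eq_or_eq_of_isLink h.isLink_right).elim hvw hvy
        · exact ⟨by simp [h.edgeSet_eq, hk], hinc k hk hvw hkv⟩
    exact fun a ha hav b hb hbv ↦ (hall a ha hav).trans (hall b hb hbv).symm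

theorem IsSeriesParallel.isSturdy (hS : IsSeriesParallel S) : IsSturdy S := by
  induction hS with
  | digon hxy hef => exact isSturdy_banana hxy hef
  | parallel _ h ih => exact ih.parallel h
  | series _ h ih => exact ih.series h

theorem IsSeriesParallel.isTwoConnected (hS : IsSeriesParallel S) : IsTwoConnected S :=
  hS.isSturdy.isTwoConnected

end

open Graph SimpleGraph

/-! ### Building a multigraph from a bipartite graph -/

section Extensions

variable {α β : Type*} {S : Graph α β} {x y w : α} {e f : β}

theorem exists_isParallelExtension (he : e ∈ E(S)) (hf : f ∉ E(S)) :
    ∃ S', IsParallelExtension S S' e f :=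
  ⟨{ vertexSet := V(S)
     IsLink := fun g a b ↦ S.IsLink g a b ∨ (g = f ∧ S.IsLink e a b)
     isLink_symm := fun _ _ ↦ ⟨fun _ _ h ↦ h.imp .symm fun h ↦ ⟨h.1, h.2.symm⟩⟩
     eq_or_eq_of_isLink_of_isLink := by
      rintro g a b c d (h | ⟨rfl, h⟩) (h' | ⟨h'', h'⟩)
      · exact h.left_eq_or_eq h'
      · exact absurd (h'' ▸ h.edge_mem) hf
      · exact absurd h'.edge_mem hf
      · exact h.left_eq_or_eq h'
     left_mem_of_isLink := fun _ _ _ h ↦ h.elim (·.left_mem) (·.2.left_mem) },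
    he, hf, rfl, fun _ _ _ ↦ .rfl⟩

theorem exists_isSeriesExtension (he : S.IsLink e x y) (hf : f ∉ E(S)) (hw : w ∉ V(S)) :
    ∃ S', IsSeriesExtension S S' e f x y w := by
  have hef : e ≠ f := fun hef ↦ hf (hef ▸ he.edge_mem)
  exact ⟨{
     vertexSet := insert w V(S)
     IsLink := fun g a b ↦ (g ≠ e ∧ S.IsLink g a b) ∨ (g = e ∧ s(a, b) = s(x, w)) ∨
      (g = f ∧ s(a, b) = s(w, y))
     isLink_symm := fun _ _ ↦ ⟨fun a b h ↦ by
      rw [Sym2.eq_swap (a := b), isLink_comm]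
      exact h⟩
     eq_or_eq_of_isLink_of_isLink := by
      rintro g a b c d (⟨hg, h⟩ | ⟨rfl, h⟩ | ⟨rfl, h⟩) (⟨hg', h'⟩ | ⟨hg', h'⟩ | ⟨hg', h'⟩)
      · exact h.left_eq_or_eq h'
      · exact absurd hg' hg
      · exact absurd (hg' ▸ h.edge_mem) hf
      · exact absurd rfl hg'
      · rw [← h', Sym2.eq_iff] at h
        tauto
      · exact absurd hg' hef
      · exact absurd h'.edge_mem hf
      · exact absurd hg'.symm hef
      · rw [← h', Sym2.eq_iff] at h
        tauto
     left_mem_of_isLink := by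
      rintro g a b (⟨-, h⟩ | ⟨-, h⟩ | ⟨-, h⟩)
      · exact .inr h.left_mem
      · rw [Sym2.eq_iff] at h
        rcases h with ⟨rfl, rfl⟩ | ⟨rfl, rfl⟩
        · exact .inr he.left_mem
        · exact .inl rfl
      · rw [Sym2.eq_iff] at h
        rcases h with ⟨rfl, rfl⟩ | ⟨rfl, rfl⟩
        · exact .inl rfl
        · exact .inr he.right_mem },
    he, hf, hw, rfl, fun _ _ _ ↦ .rfl⟩

theorem isSpanningTree_banana (hxy : x ≠ y) :
    IsSpanningTree (banana x y {e, f}) {e} := by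
  have hl : (banana x y {e, f}).IsLink e x y := by simp
  refine .of_connectedBy (by simp) ⟨x, by simp⟩ (fun a ha b hb ↦ ?_) ?_
  · have h := ConnectedBy.of_isLink (Set.mem_singleton e) hl
    simp only [vertexSet_banana, Set.mem_insert_iff, Set.mem_singleton_iff] at ha hb
    rcases ha with rfl | rfl <;> rcases hb with rfl | rfl
    · rfl
    · exact h
    · exact h.symm
    · rfl
  · rintro _ rfl
    refine ⟨x, y, hl, fun h ↦ hxy (h.eq_of_forall_not_isLink ?_)⟩
    simp

theorem fundamentalAdj_banana (hxy : x ≠ y) (hef : e ≠ f) :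
    (fundamentalAdj (banana x y {e, f}) {e}).Adj e f := by
  rw [(isSpanningTree_banana hxy).fundamentalAdj_iff rfl (by simpa using hef.symm)
    (x := x) (y := y) (by simp)]
  refine fun h ↦ hxy (h.eq_of_forall_not_isLink ?_)
  simp

end Extensions

/-- `φ` identifies `G` with the fundamental graph of a series-parallel multigraph, the vertices in
`X` corresponding to tree edges. -/
structure IsFundamentalModel {V α β : Type*} (G : SimpleGraph V) (X : Set V) (S : Graph α β)
    (T : Set β) (φ : V → β) : Prop where
  isSeriesParallel : IsSeriesParallel S
  isSpanningTree : IsSpanningTree S T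
  finite : V(S).Finite
  injective : Function.Injective φ
  range_eq : Set.range φ = E(S)
  mem_iff : ∀ x, x ∈ X ↔ φ x ∈ T
  adj_iff : ∀ a b, G.Adj a b ↔ (fundamentalAdj S T).Adj (φ a) (φ b)

section Bipartite

variable {V : Type*} {G : SimpleGraph V} {X Y : Set V} {a b u v : V}

theorem SimpleGraph.IsBipartiteWith.mem_iff_notMem (h : G.IsBipartiteWith X Y)
    (hab : G.Adj a b) : a ∈ X ↔ b ∉ X := by
  have hd := fun c (hX : c ∈ X) (hY : c ∈ Y) ↦ Set.disjoint_left.1 h.disjoint hX hY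
  rcases h.mem_of_adj hab with ⟨ha, hb⟩ | ⟨ha, hb⟩
  · exact iff_of_true ha fun hb' ↦ hd b hb' hb
  · exact iff_of_false (fun ha' ↦ hd a ha' ha) (not_not.2 hb)

open Classical in
/-- The two-coloring given by a bipartition. -/
noncomputable def SimpleGraph.IsBipartiteWith.boolColoring (h : G.IsBipartiteWith X Y) :
    G.Coloring Bool :=
  Coloring.mk (fun a ↦ decide (a ∈ X)) fun {a b} hab heq ↦ by
    have := h.mem_iff_notMem hab
    have := decide_eq_decide.1 heq
    tauto

theorem SimpleGraph.ConnectedWithin.connected [Nonempty V] (h : G.ConnectedWithin Set.univ) :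
    G.Connected :=
  (connected_iff _).2 ⟨fun a b ↦
    let ⟨_, hn⟩ := h a trivial b trivial
    ⟨hn.exists_walk.choose⟩, ‹_›⟩

/-- Deleting a pendant vertex or a false twin keeps a graph connected. -/
theorem SimpleGraph.Connected.induce_compl_singleton (h : G.Connected) (huv : u ≠ v)
    (hv : (∀ x, G.Adj v x ↔ x = u) ∨ ∀ x, G.Adj v x ↔ G.Adj u x) :
    (G.induce {v}ᶜ).Connected := by
  classical
  -- Folding `v` onto `u` sends edges to edges or to single vertices, hence preserves connectivity.
  let π : V → ({v}ᶜ : Set V) := fun x ↦ if hx : x = v then ⟨u, huv⟩ else ⟨x, hx⟩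
  have himg : π '' Set.univ = Set.univ := by
    refine Set.eq_univ_of_forall fun x ↦ ⟨x, trivial, ?_⟩
    have : (x : V) ≠ v := x.2
    simp [π, this]
  have : Nonempty ({v}ᶜ : Set V) := ⟨⟨u, huv⟩⟩
  refine ConnectedWithin.connected ?_
  rw [← himg]
  refine h.connectedWithin_univ.image fun a _ b _ hab ↦ ?_
  have key : ∀ b, b ≠ v → G.Adj v b → π v = π b ∨ (G.induce {v}ᶜ).Adj (π v) (π b) := by
    intro b hb hvb
    rcases hv with hv | hv
    · obtain rfl := (hv b).1 hvb
      simp [π, huv]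
    · refine .inr ?_
      simpa [π, hb] using (hv b).1 hvb
  by_cases ha : a = v
  · subst ha
    exact key b hab.ne' hab
  by_cases hb : b = v
  · subst hb
    exact (key a hab.ne hab.symm).imp .symm .symm
  · exact .inr (by simpa [π, ha, hb] using hab)

end Bipartite

/-- Remove a pendant vertex or twin `v` of `u`, model the rest, and let `e` be the edge of `u`:
subdivide `e` if `v` is in `X`, double it if not. Whether this yields a pendant vertex or a twin
depends on the color of `u`, which is the right one by bipartiteness. Infinite label types supply
fresh edges and vertices at each step. -/
theorem exists_isFundamentalModel_of_card {α : Type v} {β : Type w} [Infinite α] [Infinite β]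
    (n : ℕ) : ∀ {V : Type u} [Finite V] [Nontrivial V] (G : SimpleGraph V) (X Y : Set V),
      Nat.card V = n → G.Connected → G.IsBipartiteWith X Y →
      G.HasInducedCommonNeighbors Set.univ →
      ∃ (S : Graph α β) (T : Set β) (φ : V → β), IsFundamentalModel G X S T φ := by
  classical
  induction n with
  | zero =>
    intro V _ _ G X Y hn
    exact absurd hn Nat.card_pos.ne'
  | succ n ih =>
    intro V _ _ G X Y hn hconn hXY hG
    obtain ⟨u, v, huv, hv⟩ := hG.exists_pendant_or_twin hconn hXY.boolColoring
    by_cases hnt : ({v}ᶜ : Set V).Nontrivial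
    · have : Nontrivial ({v}ᶜ : Set V) := hnt.coe_sort
      have hn' : Nat.card ({v}ᶜ : Set V) = n := by
        have := Set.ncard_add_ncard_compl ({v} : Set V)
        rw [Set.ncard_singleton, hn] at this
        rw [Nat.card_coe_set_eq]
        omega
      obtain ⟨S, T, φ, hφ⟩ := ih (G.induce {v}ᶜ) (Subtype.val ⁻¹' X) (Subtype.val ⁻¹' Y) hn'
        (hconn.induce_compl_singleton huv hv)
        ⟨hXY.disjoint.preimage _, fun a b hab ↦ hXY.mem_of_adj hab⟩
        (hG.of_embedding Subtype.val_injective (fun _ _ ↦ .rfl) fun _ _ ↦ trivial)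
      have hEfin : E(S).Finite := hφ.range_eq ▸ Set.finite_range φ
      obtain ⟨f, hf⟩ := hEfin.infinite_compl.nonempty
      obtain ⟨z, hz⟩ := hφ.finite.infinite_compl.nonempty
      have hφE : ∀ x, φ x ∈ E(S) := fun x ↦ hφ.range_eq ▸ ⟨x, rfl⟩
      set e := φ ⟨u, huv⟩ with he
      have heE : e ∈ E(S) := hφE _
      have heT : u ∈ X ↔ e ∈ T := hφ.mem_iff ⟨u, huv⟩
      have hfT : f ∉ T := fun hfT ↦ hf (hφ.isSpanningTree.subset hfT)
      -- Common to both extensions: `φ` is continued by sending `v` to the new edge `f`.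
      have finish : ∀ (S' : Graph α β) (T' : Set β), IsSeriesParallel S' → IsSpanningTree S' T' →
          V(S').Finite → E(S') = insert f E(S) → (∀ g ∈ E(S), g ∈ T ↔ g ∈ T') →
          (v ∈ X ↔ f ∈ T') →
          (∀ g ∈ E(S), ∀ k ∈ E(S), (fundamentalAdj S T).Adj g k ↔ (fundamentalAdj S' T').Adj g k) →
          (∀ x, G.Adj v x.1 ↔ (fundamentalAdj S' T').Adj f (φ x)) →
          ∃ (S : Graph α β) (T : Set β) (φ : V → β), IsFundamentalModel G X S T φ := by
        intro S' T' hS' hT' hV' hE' hTT' hvX hadj hnew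
        let φ' : V → β := fun x ↦ if hx : x = v then f else φ ⟨x, hx⟩
        have hφv : φ' v = f := by simp [φ']
        have hφx : ∀ x (hx : x ≠ v), φ' x = φ ⟨x, hx⟩ := fun x hx ↦ by simp [φ', hx]
        have hφf : ∀ x, φ x ≠ f := fun x hxf ↦ hf (hxf ▸ hφE x)
        refine ⟨S', T', φ', hS', hT', hV', ?_, ?_, ?_, ?_⟩
        · intro a b hab
          by_cases ha : a = v <;> by_cases hb : b = v
          · rw [ha, hb]
          · rw [ha, hφv, hφx b hb] at hab
            exact absurd hab.symm (hφf _)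
          · rw [hb, hφv, hφx a ha] at hab
            exact absurd hab (hφf _)
          · rw [hφx a ha, hφx b hb] at hab
            exact congrArg Subtype.val (hφ.injective hab)
        · rw [hE', ← hφ.range_eq]
          ext g
          constructor
          · rintro ⟨x, rfl⟩
            by_cases hx : x = v
            · exact .inl (hx ▸ hφv)
            · exact .inr ⟨_, (hφx x hx).symm⟩
          · rintro (rfl | ⟨⟨x, hx⟩, rfl⟩)
            · exact ⟨v, hφv⟩
            · exact ⟨x, hφx x hx⟩
        · intro x
          by_cases hx : x = v
          · rw [hx, hφv, hvX]
          · rw [hφx x hx, ← hTT' _ (hφE _)]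
            exact hφ.mem_iff ⟨x, hx⟩
        · intro a b
          by_cases ha : a = v <;> by_cases hb : b = v
          · simp [ha, hb]
          · rw [ha, hφv, hφx b hb, ← hnew]
          · rw [hb, hφv, hφx a ha, SimpleGraph.adj_comm, SimpleGraph.adj_comm _ _ f, ← hnew]
          · rw [hφx a ha, hφx b hb, ← hadj _ (hφE _) _ (hφE _), ← hφ.adj_iff]
            rfl
      have heq : ∀ x : ({v}ᶜ : Set V), (x : V) = u ↔ φ x = e := fun x ↦ by
        rw [he, hφ.injective.eq_iff, Subtype.ext_iff]
      by_cases hvX : v ∈ X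
      · obtain ⟨x, y, hxy⟩ := exists_isLink_of_mem_edgeSet heE
        obtain ⟨S', h⟩ := exists_isSeriesExtension hxy hf hz
        refine finish S' (insert f T) (.series hφ.isSeriesParallel h)
          ((h.isSpanningTree_iff hφ.isSpanningTree.subset).2 hφ.isSpanningTree)
          (h.vertexSet_eq ▸ hφ.finite.insert z) h.edgeSet_eq
          (fun g hg ↦ ?_) (by simp [hvX])
          (fun g hg k hk ↦ h.fundamentalAdj_iff hφ.isSpanningTree hg hk) fun x ↦ ?_
        · have : g ≠ f := fun hgf ↦ hf (hgf ▸ hg)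
          simp [this]
        · rcases hv with hv | hv
          · have hu : e ∉ T := by
              rw [← heT, ← hXY.mem_iff_notMem ((hv u).2 rfl)]
              exact hvX
            rw [hv, h.fundamentalAdj_pendant hφ.isSpanningTree hu (hφE x), heq]
          · have hu : e ∈ T := by
              -- Twins share a neighbor `d`, hence a color.
              obtain ⟨d, -, hvd⟩ := hconn.connectedWithin_univ.exists_adj (Set.mem_univ v)
                (Set.mem_univ u) huv.symm
              rw [← heT, hXY.mem_iff_notMem ((hv d).1 hvd), ← hXY.mem_iff_notMem hvd]
              exact hvX
            rw [hv, h.fundamentalAdj_twin hφ.isSpanningTree hu (hφE x),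
              ← h.fundamentalAdj_iff hφ.isSpanningTree heE (hφE x), ← hφ.adj_iff]
            rfl
      · obtain ⟨S', h⟩ := exists_isParallelExtension heE hf
        refine finish S' T (.parallel hφ.isSeriesParallel h)
          ((h.isSpanningTree_iff hφ.isSpanningTree.subset).2 hφ.isSpanningTree)
          (h.vertexSet_eq ▸ hφ.finite) h.edgeSet_eq
          (fun g hg ↦ .rfl) (iff_of_false hvX hfT)
          (fun g hg k hk ↦ h.fundamentalAdj_iff hφ.isSpanningTree hg hk) fun x ↦ ?_
        rcases hv with hv | hv
        · have hu : e ∈ T := by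
            rw [← heT, hXY.mem_iff_notMem ((hv u).2 rfl).symm]
            exact hvX
          rw [hv, h.fundamentalAdj_pendant hφ.isSpanningTree hu, heq]
        · have hu : e ∉ T := by
            obtain ⟨d, -, hvd⟩ := hconn.connectedWithin_univ.exists_adj (Set.mem_univ v)
              (Set.mem_univ u) huv.symm
            rw [← heT, hXY.mem_iff_notMem ((hv d).1 hvd), ← hXY.mem_iff_notMem hvd]
            exact hvX
          rw [hv, h.fundamentalAdj_twin hφ.isSpanningTree hu,
            ← h.fundamentalAdj_iff hφ.isSpanningTree heE (hφE x), ← hφ.adj_iff]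
          rfl
    · -- two vertices
      have huniv : ∀ x, x = u ∨ x = v := by
        intro x
        by_contra! hx
        exact hnt ⟨x, hx.2, u, huv, hx.1⟩
      have hadj : G.Adj u v := by
        obtain ⟨d, -, hd⟩ := hconn.connectedWithin_univ.exists_adj (Set.mem_univ u)
          (Set.mem_univ v) huv
        rcases huniv d with rfl | rfl
        · exact absurd hd G.irrefl
        · exact hd
      -- The end in `X`, called `p`, becomes the tree edge of a digon.
      obtain ⟨p, q, hpq, hpX, hall⟩ : ∃ p q, G.Adj p q ∧ p ∈ X ∧ ∀ x, x = p ∨ x = q := by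
        by_cases huX : u ∈ X
        · exact ⟨u, v, hadj, huX, huniv⟩
        · refine ⟨v, u, hadj.symm, ?_, fun x ↦ (huniv x).symm⟩
          rwa [hXY.mem_iff_notMem hadj.symm]
      obtain ⟨x, y, hxy⟩ := exists_pair_ne α
      obtain ⟨e, f, hef⟩ := exists_pair_ne β
      have hqX := (hXY.mem_iff_notMem hpq).1 hpX
      have hqp : q ≠ p := hpq.ne'
      refine ⟨banana x y {e, f}, {e}, fun z ↦ if z = p then e else f, .digon hxy hef,
        isSpanningTree_banana hxy, by simp, ?_, ?_, ?_, ?_⟩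
      · intro a b hab
        rcases hall a with rfl | rfl <;> rcases hall b with rfl | rfl <;>
          simp_all [hef.symm]
      · ext g
        constructor
        · rintro ⟨a, rfl⟩
          rcases hall a with rfl | rfl <;> simp [hqp]
        · rintro (rfl | rfl)
          · exact ⟨p, by simp⟩
          · exact ⟨q, by simp [hqp]⟩
      · intro a
        rcases hall a with rfl | rfl
        · simp [hpX]
        · simp [hqX, hqp, hef.symm]
      · have h := fundamentalAdj_banana (x := x) (y := y) hxy hef
        intro a b
        rcases hall a with rfl | rfl <;> rcases hall b with rfl | rfl
        · simp
        · simp [hqp, hpq, h]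
        · simp [hqp, hpq.symm, h.symm]
        · simp

/-- Finite connected bipartite graphs with the common neighbor property
are fundamental graphs, with prescribed color classes. -/
theorem SimpleGraph.HasInducedCommonNeighbors.exists_fundamentalGraph_iso {V : Type u} [Finite V]
    [Nontrivial V] {G : SimpleGraph V} {X Y : Set V} (h : G.HasInducedCommonNeighbors Set.univ)
    (hconn : G.Connected) (hXY : G.IsBipartiteWith X Y) :
    ∃ (α : Type v) (β : Type w) (S : Graph α β) (T : Set β),
      IsTwoConnected S ∧ IsSeriesParallel S ∧ IsSpanningTree S T ∧
        ∃ φ : G ≃g fundamentalGraph S T, ∀ x, x ∈ X ↔ (φ x : β) ∈ T := by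
  -- Lifted copies of ℕ are infinite label types in the prescribed universes.
  obtain ⟨S, T, φ, hφ⟩ := exists_isFundamentalModel_of_card (α := ULift.{v} ℕ) (β := ULift.{w} ℕ)
    (Nat.card V) G X Y rfl hconn hXY h
  refine ⟨_, _, S, T, hφ.isSeriesParallel.isTwoConnected, hφ.isSeriesParallel, hφ.isSpanningTree,
    ⟨(Equiv.ofInjective φ hφ.injective).trans (Equiv.setCongr hφ.range_eq), ?_⟩, hφ.mem_iff⟩
  intro a b
  exact (hφ.adj_iff a b).symm

/-- Graphs isomorphic to fundamental graphs of series-parallel multigraphs are distance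
hereditary. -/
theorem IsSeriesParallel.isDistanceHereditary_of_iso {V α β : Type*} {G : SimpleGraph V}
    {S : Graph α β} {T : Set β} (hS : IsSeriesParallel S) (hT : IsSpanningTree S T)
    (φ : G ≃g fundamentalGraph S T) : IsDistanceHereditary G := by
  rw [isDistanceHereditary_iff_hasInducedCommonNeighbors]
  exact (hS.hasInducedCommonNeighbors T hT).of_embedding (f := fun x ↦ (φ x : β))
    (Subtype.val_injective.comp φ.injective) (fun a b ↦ φ.map_adj_iff) fun x _ ↦ (φ x).2

/-- As `G` is connected and nontrivial, every vertex lies on an edge and `Y` is the complement of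
`X`; matching `X` with `T` therefore also matches `Y` with the cotree edges. -/
theorem theorem5 {V : Type u} [Finite V] [Nontrivial V] (G : SimpleGraph V)
    (hconn : G.Connected) (X Y : Set V) (hXY : G.IsBipartiteWith X Y) :
    (IsBDH G ↔
      ∃ (α : Type v) (β : Type w) (S : Graph α β) (T : Set β),
        IsTwoConnected S ∧ IsSeriesParallel S ∧ IsSpanningTree S T ∧
          Nonempty (G ≃g fundamentalGraph S T)) ∧
    (IsBDH G ↔
      ∃ (α : Type v) (β : Type w) (S : Graph α β) (T : Set β),
        IsTwoConnected S ∧ IsSeriesParallel S ∧ IsSpanningTree S T ∧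
          ∃ φ : G ≃g fundamentalGraph S T, ∀ x, x ∈ X ↔ (φ x : β) ∈ T) := by
  have forward (h : IsBDH G) := HasInducedCommonNeighbors.exists_fundamentalGraph_iso
    (isDistanceHereditary_iff_hasInducedCommonNeighbors.1 h.2) hconn hXY
  have hbip : G.IsBipartite := isBipartite_iff_exists_isBipartiteWith.2 ⟨X, Y, hXY⟩
  refine ⟨⟨fun h ↦ ?_, ?_⟩, forward, ?_⟩
  · obtain ⟨α, β, S, T, h2, hS, hT, φ, -⟩ := forward h
    exact ⟨α, β, S, T, h2, hS, hT, ⟨φ⟩⟩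
  · rintro ⟨α, β, S, T, -, hS, hT, ⟨φ⟩⟩
    exact ⟨hbip, hS.isDistanceHereditary_of_iso hT φ⟩
  · rintro ⟨α, β, S, T, -, hS, hT, φ, -⟩
    exact ⟨hbip, hS.isDistanceHereditary_of_iso hT φ⟩
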